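/- Let $N\ge 1$ and let $\theta\in\mathbb R$, $\theta\neq 0$. Let $S=\begin{pmatrix}0&1_N\\-1_N&0\end{pmatrix}$, and for Schwartz functions $f,g\in\mathcal S(\mathbb R^{2N})$ let $$ (f\star_\theta g)(x)=(\pi\theta)^{-2N}\iint f(y)\,g(z)\,e^{\frac{2i}{\theta}(x-y)\cdot S(x-z)}\,d^{2N}y\,d^{2N}z $$ be their Moyal product. Let $A^0_\theta$ be the $C^*$-algebra of bounded operators on $L^2(\mathbb R^{2N})$ generated by the left multiplications $L^\theta_f$, $f\in\mathcal S(\mathbb R^{2N})$, where $L^\theta_f$ is the bounded operator on $L^2(\mathbb R^{2N})$ that satisfies $L^\theta_f g=f\star_\theta g$ for $g\in\mathcal S(\mathbb R^{2N})$. Then $\mathcal A_\theta=(\mathcal S(\mathbb R^{2N}),\star_\theta)$, with complex conjugation as involution and the usual topology of $\mathcal S(\mathbb R^{2N})$, is a nonunital Fréchet pre-$C^*$-algebra with $C^*$-completion $A^0_\theta$. That is: 1. $\mathcal S(\mathbb R^{2N})$ is a Fréchet space; $\star_\theta$ is a bilinear, associative, jointly continuous product $\mathcal S\times\mathcal S\to\mathcal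 S$ without identity element; complex conjugation is a continuous involution for it. 2. Each $L^\theta_f$ with $f\in\mathcal S(\mathbb R^{2N})$ exists as a bounded operator on $L^2(\mathbb R^{2N})$, and $f\mapsto L^\theta_f$ is an injective continuous $*$-homomorphism of $\mathcal A_\theta$ onto a dense subalgebra of $A^0_\theta$. 3. $\mathcal A_\theta$ is stable under the holomorphic functional calculus in $A^0_\theta$: if $b=\lambda 1+L^\theta_f$ with $\lambda\in\mathbb C$, $f\in\mathcal S(\mathbb R^{2N})$, is regarded as an element of the unitization of $A^0_\theta$, if $h$ is holomorphic on an open set $U$ containing the spectrum of $b$, and if $\Gamma$ is any cycle in $U$ that surrounds the spectrum of $b$ (it avoids the spectrum, and has winding number $1$ about each point of the spectrum and $0$ about each point outside $U$), then $$ h(b)=\frac1{2\pi i}\oint_\Gamma h(z)\,(z-b)^{-1}\,dz $$ is again of the form $\mu 1+L^\theta_{k}$ with $\mu\in\mathbb C$ and $k\in\mathcal S(\mathbb R^{2N})$. 4. In particular, quasi-inverses stay in $\mathcal S$: if $f\in\mathcal S(\mathbb R^{2N})$ and $G\in A^0_\theta$ satisfy $L^\theta_f+G+L^\theta_fG=0=L^\theta_f+G+GL^\theta_f$,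 then $G=L^\theta_g$ for some $g\in\mathcal S(\mathbb R^{2N})$. -/

import Mathlib

open MeasureTheory SchwartzMap
open scoped Matrix ComplexConjugate

noncomputable section

/-! ### Fréchet algebras and stability under the holomorphic functional calculus -/

/-- A complex Fréchet space: a complete Hausdorff topological vector space whose topology is
defined by a countable family of seminorms. -/
structure IsFrechetSpace (E : Type*) [AddCommGroup E] [Module ℂ E] [UniformSpace E]
    [IsUniformAddGroup E] : Prop where
  exists_seminorms : ∃ p : SeminormFamily ℂ E ℕ, WithSeminorms p
  t2 : T2Space E
  complete : CompleteSpace E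

/-- `𝒜`, with the product `mul` and the involution `inv`, is an associative involutive (not
necessarily unital) Fréchet algebra with jointly continuous product and continuous involution. -/
structure IsFrechetStarAlgebra {𝒜 : Type*} [AddCommGroup 𝒜] [Module ℂ 𝒜] [UniformSpace 𝒜]
    [IsUniformAddGroup 𝒜] (mul : 𝒜 →ₗ[ℂ] 𝒜 →ₗ[ℂ] 𝒜) (inv : 𝒜 →ₗ⋆[ℂ] 𝒜) : Prop where
  frechet : IsFrechetSpace 𝒜
  mul_assoc : ∀ a b c, mul (mul a b) c = mul a (mul b c)
  inv_inv : ∀ a, inv (inv a) = a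
  inv_mul : ∀ a b, inv (mul a b) = mul (inv b) (inv a)
  continuous_mul : Continuous fun p : 𝒜 × 𝒜 => mul p.1 p.2
  continuous_inv : Continuous inv

/-- A cycle in the complex plane: finitely many closed `C¹` curves parametrized by `[0, 1]`.
The derivative may vanish, so that a piecewise `C¹` closed curve is covered after
reparametrization. -/
structure Cycle1 where
  n : ℕ
  γ : Fin n → ℝ → ℂ
  contDiff : ∀ i, ContDiff ℝ 1 (γ i)
  closed : ∀ i, γ i 0 = γ i 1

/-- The integral of a vector-valued function `F` of a complex variable along the cycle `Γ`. -/
def Cycle1.integral {B : Type*} [NormedAddCommGroup B] [NormedSpace ℂ B] (Γ : Cycle1)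
    (F : ℂ → B) : B :=
  ∑ i, ∫ t in (0 : ℝ)..1, deriv (Γ.γ i) t • F (Γ.γ i t)

/-- The winding number of `Γ` around `w` (for `w` not on `Γ`). -/
def Cycle1.index (Γ : Cycle1) (w : ℂ) : ℂ :=
  (2 * Real.pi * Complex.I)⁻¹ * Γ.integral fun z => (z - w)⁻¹

/-- `Γ` surrounds `K` in `U`: it runs in `U \ K`, winds once around every point of `K`, and does
not wind around any point outside `U`. -/
structure Cycle1.Surrounds (Γ : Cycle1) (K U : Set ℂ) : Prop where
  mem : ∀ i, ∀ t ∈ Set.Icc (0 : ℝ) 1, Γ.γ i t ∈ U \ K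
  index_eq_one : ∀ w ∈ K, Γ.index w = 1
  index_eq_zero : ∀ w ∉ U, Γ.index w = 0

/-- The holomorphic functional calculus in a unital complex Banach algebra:
`h(b) = (2πi)⁻¹ ∮_Γ h(z) (z - b)⁻¹ dz`, where `h` is holomorphic on an open set `U` containing the
spectrum of `b` and `Γ` surrounds the spectrum of `b` in `U`. -/
def holomorphicCalculus {B : Type*} [NormedRing B] [NormedAlgebra ℂ B] (b : B) (h : ℂ → ℂ)
    (Γ : Cycle1) : B :=
  (2 * Real.pi * Complex.I)⁻¹ • Γ.integral fun z => h z • resolvent b z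

/-- The linear map `ι` exhibits the involutive algebra `(𝒜, mul, inv)` as a Fréchet
pre-C⋆-algebra with C⋆-completion `A`: `𝒜` is an involutive Fréchet algebra, `ι` is an injective
continuous ⋆-homomorphism with dense range, and the unitization of `𝒜` is stable under the
holomorphic functional calculus in the unitization of `A`. -/
structure IsFrechetPreCStarAlgebra {𝒜 : Type*} [AddCommGroup 𝒜] [Module ℂ 𝒜] [UniformSpace 𝒜]
    [IsUniformAddGroup 𝒜] (mul : 𝒜 →ₗ[ℂ] 𝒜 →ₗ[ℂ] 𝒜) (inv : 𝒜 →ₗ⋆[ℂ] 𝒜)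
    {A : Type*} [NonUnitalCStarAlgebra A] (ι : 𝒜 →ₗ[ℂ] A) : Prop
    extends IsFrechetStarAlgebra mul inv where
  map_mul : ∀ a b, ι (mul a b) = ι a * ι b
  map_inv : ∀ a, ι (inv a) = star (ι a)
  injective : Function.Injective ι
  continuous : Continuous ι
  denseRange : DenseRange ι
  stable : ∀ b : Unitization ℂ A, b.snd ∈ Set.range ι →
    ∀ (U : Set ℂ) (h : ℂ → ℂ), IsOpen U → spectrum ℂ b ⊆ U → DifferentiableOn ℂ h U →
    ∀ Γ : Cycle1, Γ.Surrounds (spectrum ℂ b) U →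
      (holomorphicCalculus b h Γ).snd ∈ Set.range ι

/-! ### The Moyal product -/

/-- The phase space `ℝ²ᴺ = ℝᴺ ⊕ ℝᴺ` with its Euclidean structure. -/
abbrev PhaseSpace (N : ℕ) : Type := EuclideanSpace ℝ (Fin N ⊕ Fin N)

/-- The standard symplectic matrix `S = (0, 1; -1, 0)`. -/
def symplecticS (N : ℕ) : Matrix (Fin N ⊕ Fin N) (Fin N ⊕ Fin N) ℝ :=
  Matrix.fromBlocks 0 1 (-1) 0

/-- The Moyal product
`(f ⋆ g)(x) = (πθ)^(-2N) ∬ f(y) g(z) exp ((2i/θ) (x - y) · S (x - z)) dy dz`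
of functions on phase space. -/
def moyalProduct {N : ℕ} (θ : ℝ) (f g : PhaseSpace N → ℂ) (x : PhaseSpace N) : ℂ :=
  (((Real.pi * θ) ^ (2 * N))⁻¹ : ℝ) * ∫ y, ∫ z, f y * g z *
    Complex.exp (2 * Complex.I / θ * ((x - y).ofLp ⬝ᵥ (symplecticS N *ᵥ (x - z).ofLp) : ℝ))

/-- Complex conjugation of Schwartz functions. -/
def schwartzConj (N : ℕ) : 𝓢(PhaseSpace N, ℂ) →ₗ⋆[ℂ] 𝓢(PhaseSpace N, ℂ) where
  toFun f := SchwartzMap.postcompCLM (𝕜 := ℝ) (Complex.conjCLE : ℂ →L[ℝ] ℂ) f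
  map_add' f g := by ext x; simp
  map_smul' c f := by ext x; simp

theorem schwartzConj_apply {N : ℕ} (f : 𝓢(PhaseSpace N, ℂ)) (x : PhaseSpace N) :
    schwartzConj N f x = conj (f x) := rfl

/-- The Hilbert space `L²(ℝ²ᴺ)`. -/
abbrev L2 (N : ℕ) : Type := Lp ℂ 2 (volume : Measure (PhaseSpace N))

/-- The bounded operator `T` on `L²(ℝ²ᴺ)` is left Moyal multiplication by the Schwartz function
`f`: on the dense subspace of Schwartz functions `g` it is given by `T g = f ⋆ g`. -/
def IsLeftMoyal {N : ℕ} (θ : ℝ) (f : 𝓢(PhaseSpace N, ℂ)) (T : L2 N →L[ℂ] L2 N) : Prop :=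
  ∀ g : 𝓢(PhaseSpace N, ℂ), (T (g.toLp 2) : PhaseSpace N → ℂ) =ᵐ[volume] moyalProduct θ f g

/-- The C⋆-algebra `A⁰_θ` of bounded operators on `L²(ℝ²ᴺ)` generated by the left Moyal
multiplications by Schwartz functions. (They form a ⋆-algebra, hence this is their closure in the
operator norm.) -/
def moyalCStar (N : ℕ) (θ : ℝ) : NonUnitalStarSubalgebra ℂ (L2 N →L[ℂ] L2 N) :=
  (NonUnitalStarAlgebra.adjoin ℂ
    {T | ∃ f : 𝓢(PhaseSpace N, ℂ), IsLeftMoyal θ f T}).topologicalClosure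

instance moyalCStar_isClosed (N : ℕ) (θ : ℝ) :
    IsClosed (moyalCStar N θ : Set (L2 N →L[ℂ] L2 N)) :=
  NonUnitalStarSubalgebra.isClosed_topologicalClosure _

end

/-! Write e(s) = exp(2πis) and K = -πθS, a skew map. The substitution y = x + Kw turns the
oscillatory double integral into the absolutely convergent (f ⋆ g)(x) = ∫ e(⟨w,x⟩) ĝ(w) f(x + Kw)
dw, a superposition of modulated translates of f (`moyalProduct_eq_twist`). Fourier inversion
exchanges the roles of f and g at the cost of replacing K by -K. Associativity, the involution, the
trace identity ∫ f ⋆ g = ∫ fg and bounds in sup norm and in L² all come from this form. Derivatives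
and coordinate multiples of f ⋆ g are again sums of such products, so a sup bound yields bounds on
all Schwartz seminorms (`exists_weyl_bound`).

The heart is that 𝒮 absorbs two-sided products: for every T in A⁰_θ, L_f T L_g is again some L_k
with k in 𝒮 (`exists_leftOp_eq_sandwich`). For T = L_t, the sup norm of f ⋆ t ⋆ g is at most a
constant times ‖f̂‖₂ ‖L_t‖ ‖g‖₂. Twisted multiplication by a linear function from the left acts on f
alone, and from the right on g alone. As K is onto, these operations generate all coordinates and
derivatives, so each Schwartz seminorm of f ⋆ t ⋆ g is at most C‖L_t‖ with C independent of t.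
Completeness of 𝒮 then covers limits of the L_t.

Stability is now algebra. If b = λ + x and w = z - λ, then (z - b)⁻¹ = w⁻¹ + w⁻² x + w⁻² x (z - b)⁻¹
x, so the contour integral is a scalar plus a multiple of x plus some x y x
(`snd_holomorphicCalculus_mem_range`). Likewise a quasi-inverse satisfies g = -f + f² + f g f. -/

noncomputable section

open Filter Topology
open scoped FourierTransform LineDeriv ContDiff

set_option linter.unusedSectionVars false

/-! ### The Schwartz space is a Fréchet space -/

section Complete

variable {E F : Type*} [NormedAddCommGroup E] [NormedSpace ℝ E] [NormedAddCommGroup F]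
  [NormedSpace ℝ F]

theorem tendsto_seminorm_sub_of_cauchySeq {V : Type*} [AddCommGroup V] [Module ℝ V]
    [UniformSpace V] [IsUniformAddGroup V] {p : Seminorm ℝ V} (hp : Continuous p) {u : ℕ → V}
    (hu : CauchySeq u) {ε : ℝ} (hε : 0 < ε) : ∃ M, ∀ m ≥ M, ∀ n ≥ M, p (u m - u n) ≤ ε := by
  have h1 : Tendsto (fun x : ℕ × ℕ => u x.2 - u x.1) atTop (𝓝 0) := by
    have := hu.tendsto_uniformity
    rw [uniformity_eq_comap_nhds_zero, tendsto_comap_iff] at this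
    exact this
  have h2 : Tendsto (fun x : ℕ × ℕ => p (u x.2 - u x.1)) atTop (𝓝 0) := by
    simpa [Function.comp_def] using (hp.tendsto 0).comp h1
  rw [← prod_atTop_atTop_eq] at h2
  have h3 := h2.eventually (gt_mem_nhds hε)
  rw [prod_atTop_atTop_eq, eventually_atTop] at h3
  obtain ⟨⟨a, b⟩, hab⟩ := h3
  refine ⟨max a b, fun m hm n hn => (hab (n, m) ⟨?_, ?_⟩).le⟩
  · exact (le_max_left _ _).trans hn
  · exact (le_max_right _ _).trans hm

theorem continuous_schwartz_seminorm (k n : ℕ) :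
    Continuous (SchwartzMap.seminorm ℝ k n : Seminorm ℝ 𝓢(E, F)) :=
  (schwartz_withSeminorms ℝ E F).continuous_seminorm (k, n)

/-- For a Cauchy sequence all iterated derivatives converge uniformly, so their limits are the
derivatives of one smooth function; the weighted estimates survive the pointwise limit. -/
instance schwartz_completeSpace [CompleteSpace F] : CompleteSpace 𝓢(E, F) := by
  have : (uniformity 𝓢(E, F)).IsCountablyGenerated :=
    IsUniformAddGroup.uniformity_countably_generated
  refine UniformSpace.complete_of_cauchySeq_tendsto fun u hu => ?_
  have key : ∀ k n : ℕ, ∀ ε > 0, ∃ M, ∀ m ≥ M, ∀ j ≥ M, ∀ x,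
      ‖x‖ ^ k * ‖iteratedFDeriv ℝ n (u m) x - iteratedFDeriv ℝ n (u j) x‖ ≤ ε := by
    intro k n ε hε
    obtain ⟨M, hM⟩ := tendsto_seminorm_sub_of_cauchySeq
      (continuous_schwartz_seminorm (E := E) (F := F) k n) hu hε
    refine ⟨M, fun m hm j hj x => le_trans ?_ (hM m hm j hj)⟩
    have := SchwartzMap.le_seminorm ℝ k n (u m - u j) x
    have h2 : (⇑(u m - u j) : E → F) = ⇑(u m) - ⇑(u j) := by ext; simp
    rwa [h2, iteratedFDeriv_sub ((u m).smooth n) ((u j).smooth n)] at this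
  have hlim : ∀ (n : ℕ) (x : E), ∃ y, Tendsto (fun m => iteratedFDeriv ℝ n (u m) x) atTop (𝓝 y) := by
    intro n x
    apply cauchySeq_tendsto_of_complete
    rw [Metric.cauchySeq_iff]
    intro ε hε
    obtain ⟨M, hM⟩ := key 0 n (ε / 2) (half_pos hε)
    refine ⟨M, fun m hm j hj => ?_⟩
    have := hM m hm j hj x
    rw [dist_eq_norm]
    simp only [pow_zero, one_mul] at this
    linarith
  choose g hg using hlim
  have key2 : ∀ k n : ℕ, ∀ ε > 0, ∃ M, ∀ m ≥ M, ∀ x,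
      ‖x‖ ^ k * ‖iteratedFDeriv ℝ n (u m) x - g n x‖ ≤ ε := by
    intro k n ε hε
    obtain ⟨M, hM⟩ := key k n ε hε
    refine ⟨M, fun m hm x => ?_⟩
    refine le_of_tendsto (((hg n x).const_sub _).norm.const_mul _)
      (eventually_atTop.2 ⟨M, fun j hj => hM m hm j hj x⟩)
  have hunif : ∀ n, TendstoUniformly (fun m => iteratedFDeriv ℝ n (u m)) (g n) atTop := by
    intro n
    rw [Metric.tendstoUniformly_iff]
    intro ε hε
    obtain ⟨M, hM⟩ := key2 0 n (ε / 2) (half_pos hε)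
    filter_upwards [eventually_ge_atTop M] with m hm x
    have := hM m hm x
    rw [dist_comm, dist_eq_norm]
    simp only [pow_zero, one_mul] at this
    linarith
  have hsm : ∀ m (n : ℕ), ContDiff ℝ n (u m) := fun m n => (u m).smooth n
  -- Uniform convergence of the derivatives of order n + 1 identifies `g (n + 1)` as the derivative
  -- of `g n`.
  have hT : HasFTaylorSeriesUpTo ∞ (fun x => (g 0 x).curry0) (fun x n => g n x) := by
    refine ⟨fun x => rfl, fun n _ x => ?_, fun n _ => ?_⟩
    · refine hasFDerivAt_of_tendstoUniformly
        (f := fun m => iteratedFDeriv ℝ n (u m)) (g' := fun x => (g (n + 1) x).curryLeft)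
        (f' := fun m x => (iteratedFDeriv ℝ (n + 1) (u m) x).curryLeft) (l := atTop)
        ?_ ?_ (fun x => hg n x) x
      · exact (continuousMultilinearCurryLeftEquiv ℝ (fun _ : Fin (n + 1) => E)
          F).isometry.uniformContinuous.comp_tendstoUniformly (hunif (n + 1))
      · intro m x
        exact (contDiff_iff_ftaylorSeries.1 (hsm m (n + 1))).fderiv n (by exact_mod_cast Nat.lt_succ_self n) x
    · exact (hunif n).continuous (Frequently.of_forall fun m => (hsm m n).continuous_iteratedFDeriv le_rfl)
  have hcd := hT.contDiff
  have heq : ∀ n x, g n x = iteratedFDeriv ℝ n (fun x => (g 0 x).curry0) x := fun n x =>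
    hT.eq_iteratedFDeriv (by exact_mod_cast le_top) x
  let f : 𝓢(E, F) := ⟨fun x => (g 0 x).curry0, hcd, fun k n => by
    obtain ⟨M, hM⟩ := key2 k n 1 one_pos
    refine ⟨SchwartzMap.seminorm ℝ k n (u M) + 1, fun x => ?_⟩
    have h1 := hM M le_rfl x
    have h2 := SchwartzMap.le_seminorm ℝ k n (u M) x
    rw [← heq]
    have h3 : ‖g n x‖ ≤ ‖iteratedFDeriv ℝ n (u M) x‖ + ‖iteratedFDeriv ℝ n (u M) x - g n x‖ := by
      rw [norm_sub_rev]; exact norm_le_norm_add_norm_sub' _ _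
    have := mul_le_mul_of_nonneg_left h3 (pow_nonneg (norm_nonneg x) k)
    linarith⟩
  refine ⟨f, ?_⟩
  rw [(schwartz_withSeminorms ℝ E F).tendsto_nhds_atTop]
  rintro ⟨k, n⟩ ε hε
  obtain ⟨M, hM⟩ := key2 k n (ε / 2) (half_pos hε)
  refine ⟨M, fun m hm => lt_of_le_of_lt ?_ (half_lt_self hε)⟩
  refine SchwartzMap.seminorm_le_bound ℝ k n _ (half_pos hε).le fun x => ?_
  have h2 : (⇑(u m - f) : E → F) = ⇑(u m) - ⇑f := by ext; simp
  rw [h2, iteratedFDeriv_sub ((u m).smooth n) (f.smooth n)]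
  have := hM m hm x
  rw [heq] at this
  exact this

theorem schwartz_isFrechetSpace {G : Type*} [NormedAddCommGroup G] [NormedSpace ℂ G]
    [CompleteSpace G] : IsFrechetSpace 𝓢(E, G) where
  exists_seminorms := by
    let e : ℕ ≃ ℕ × ℕ := Nat.pairEquiv.symm
    exact ⟨fun n => schwartzSeminormFamily ℂ E G (e n),
      (schwartz_withSeminorms ℂ E G).congr_equiv e⟩
  t2 := inferInstance
  complete := inferInstance

end Complete

/-! ### Holomorphic functional calculus in a subalgebra absorbing two-sided products -/

section Stable

/-- With w = z - b.fst, x the part of b in A and R the resolvent, wR = 1 + xR = 1 + Rx; inserting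
one equation into the other leaves R only between two factors x. The scalar w is nonzero because the
character `fst` preserves units. -/
theorem resolvent_eq_of_add_inr {A : Type*} [NonUnitalCStarAlgebra A] (b : Unitization ℂ A) {z : ℂ}
    (hz : z ∈ resolventSet ℂ b) :
    z - b.fst ≠ 0 ∧ resolvent b z = (z - b.fst)⁻¹ • (1 : Unitization ℂ A) +
      ((z - b.fst)⁻¹ ^ 2 • (Unitization.inr b.snd : Unitization ℂ A) +
        (z - b.fst)⁻¹ ^ 2 •
          ((Unitization.inr b.snd : Unitization ℂ A) * resolvent b z * Unitization.inr b.snd)) := by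
  have hu : IsUnit (algebraMap ℂ (Unitization ℂ A) z - b) := hz
  have hw : z - b.fst ≠ 0 := by
    have := hu.map (Unitization.fstHom ℂ A)
    rw [map_sub, AlgHom.commutes] at this
    exact this.ne_zero
  refine ⟨hw, ?_⟩
  set w := z - b.fst with hwdef
  set x : Unitization ℂ A := Unitization.inr b.snd with hx
  have hb : algebraMap ℂ (Unitization ℂ A) z - b = w • 1 - x := by
    conv_lhs => rw [← Unitization.inl_fst_add_inr_snd_eq b, ← Unitization.algebraMap_eq_inl,
      ← sub_sub, ← map_sub, Algebra.algebraMap_eq_smul_one]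
  have hR : resolvent b z = Ring.inverse (w • 1 - x) := by rw [resolvent, hb]
  set R := resolvent b z
  rw [hb] at hu
  have h1 : (w • 1 - x) * R = 1 := by rw [hR]; exact Ring.mul_inverse_cancel _ hu
  have h2 : R * (w • 1 - x) = 1 := by rw [hR]; exact Ring.inverse_mul_cancel _ hu
  have h1' : w • R = 1 + x * R := by
    rw [sub_mul, smul_mul_assoc, one_mul] at h1; rw [← h1]; abel
  have h2' : w • R = 1 + R * x := by
    rw [mul_sub, mul_smul_comm, mul_one] at h2; rw [← h2]; abel
  have h3 : w • w • R = w • 1 + (x + x * R * x) := by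
    rw [h1', smul_add, ← mul_smul_comm, h2', mul_add, mul_one, mul_assoc]
  have h4 : R = w⁻¹ • w⁻¹ • w • w • R := by
    rw [inv_smul_smul₀ hw, inv_smul_smul₀ hw]
  calc R = w⁻¹ • w⁻¹ • w • w • R := h4
    _ = w⁻¹ • w⁻¹ • (w • 1 + (x + x * R * x)) := by rw [h3]
    _ = _ := by rw [smul_add, inv_smul_smul₀ hw, smul_add, smul_smul, ← sq, smul_add]

theorem snd_holomorphicCalculus_mem_range {𝒜 : Type*} [AddCommGroup 𝒜] [Module ℂ 𝒜] {A : Type*}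
    [NonUnitalCStarAlgebra A] (ι : 𝒜 →ₗ[ℂ] A)
    (hmul : ∀ a b, ι a * ι b ∈ Set.range ι) (hmid : ∀ a x b, ι a * x * ι b ∈ Set.range ι)
    (b : Unitization ℂ A) (hb : b.snd ∈ Set.range ι) (U : Set ℂ) (h : ℂ → ℂ)
    (hh : DifferentiableOn ℂ h U) (Γ : Cycle1)
    (hΓ : ∀ i, ∀ t ∈ Set.Icc (0 : ℝ) 1, Γ.γ i t ∈ U \ spectrum ℂ b) :
    (holomorphicCalculus b h Γ).snd ∈ Set.range ι := by
  obtain ⟨f, hf⟩ := hb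
  let V : Submodule ℂ (Unitization ℂ A) :=
    (LinearMap.range ι).comap (Unitization.sndHom ℂ ℂ A)
  have hV : ∀ y, y ∈ V ↔ y.snd ∈ Set.range ι := fun y => Iff.rfl
  set x : Unitization ℂ A := Unitization.inr b.snd with hx
  have h1V : (1 : Unitization ℂ A) ∈ V := by
    rw [hV, Unitization.snd_one]; exact ⟨0, map_zero ι⟩
  have hxV : x ∈ V := by rw [hV, hx, Unitization.snd_inr]; exact ⟨f, hf⟩
  -- The scalar part of y contributes a multiple of x², which is where `hmul` enters besides `hmid`.
  have hxyV : ∀ y : Unitization ℂ A, x * y * x ∈ V := by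
    intro y
    have : x * y * x = y.fst • (x * x) + x * (y.snd : Unitization ℂ A) * x := by
      conv_lhs => rw [← Unitization.inl_fst_add_inr_snd_eq y]
      rw [mul_add, add_mul, ← Unitization.algebraMap_eq_inl, ← Algebra.commutes, mul_assoc,
        Algebra.smul_def]
    rw [this]
    refine V.add_mem (V.smul_mem _ ?_) ?_
    · rw [hV, hx, ← Unitization.inr_mul, Unitization.snd_inr, ← hf]; exact hmul _ _
    · rw [hV, hx, ← Unitization.inr_mul, ← Unitization.inr_mul, Unitization.snd_inr, ← hf]
      exact hmid _ _ _
  rw [← hV, holomorphicCalculus]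
  refine V.smul_mem _ (V.sum_mem fun i _ => ?_)
  set γ := Γ.γ i
  have hγ : ∀ t ∈ Set.uIcc (0 : ℝ) 1, γ t ∈ U \ spectrum ℂ b := by
    rw [Set.uIcc_of_le zero_le_one]; exact hΓ i
  have hres : ∀ t ∈ Set.uIcc (0 : ℝ) 1, γ t ∈ resolventSet ℂ b := fun t ht => by
    have := (hγ t ht).2
    rwa [spectrum, Set.mem_compl_iff, not_not] at this
  have hγc : Continuous γ := (Γ.contDiff i).continuous
  let c : ℝ → ℂ := fun t => deriv γ t * h (γ t)
  have hc : ContinuousOn c (Set.uIcc 0 1) :=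
    ((Γ.contDiff i).continuous_deriv le_rfl).continuousOn.mul
      (hh.continuousOn.comp hγc.continuousOn fun t ht => (hγ t ht).1)
  let v : ℝ → ℂ := fun t => (γ t - b.fst)⁻¹
  have hv : ContinuousOn v (Set.uIcc 0 1) :=
    (hγc.sub continuous_const).continuousOn.inv₀ fun t ht => (resolvent_eq_of_add_inr b (hres t ht)).1
  let R : ℝ → Unitization ℂ A := fun t => resolvent b (γ t)
  have hR : ContinuousOn R (Set.uIcc 0 1) := fun t ht =>
    ((spectrum.hasDerivAt_resolvent_const_left (hres t ht)).continuousAt.comp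
      hγc.continuousAt).continuousWithinAt
  have hexp : ∀ t ∈ Set.uIcc (0 : ℝ) 1, deriv γ t • h (γ t) • resolvent b (γ t) =
      (c t * v t) • (1 : Unitization ℂ A) + ((c t * v t ^ 2) • x +
        x * ((c t * v t ^ 2) • R t) * x) := by
    intro t ht
    have := (resolvent_eq_of_add_inr b (hres t ht)).2
    rw [this, smul_smul, smul_add, smul_add, smul_smul, smul_smul, smul_smul, mul_smul_comm,
      smul_mul_assoc]
  rw [intervalIntegral.integral_congr hexp, intervalIntegral.integral_add,
    intervalIntegral.integral_add, intervalIntegral.integral_smul_const,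
    intervalIntegral.integral_smul_const]
  · refine V.add_mem (V.smul_mem _ h1V) (V.add_mem (V.smul_mem _ hxV) ?_)
    -- Since y ↦ x y x is bounded, it can be pulled out of the integral. What remains inside is
    -- integrated in the ambient algebra, so no convergence in `𝒜` is at stake.
    let Λ : Unitization ℂ A →L[ℂ] Unitization ℂ A :=
      (ContinuousLinearMap.mul ℂ _).flip x ∘L (ContinuousLinearMap.mul ℂ _ x)
    have : ∫ t in (0 : ℝ)..1, x * ((c t * v t ^ 2) • R t) * x =
        Λ (∫ t in (0 : ℝ)..1, (c t * v t ^ 2) • R t) :=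
      Λ.intervalIntegral_comp_comm (((hc.mul (hv.pow 2)).smul hR).intervalIntegrable)
    rw [this]
    exact hxyV _
  · exact ((hc.mul (hv.pow 2)).smul continuousOn_const).intervalIntegrable
  · exact ((continuousOn_const.mul ((hc.mul (hv.pow 2)).smul hR)).mul
      continuousOn_const).intervalIntegrable
  · exact ((hc.mul hv).smul continuousOn_const).intervalIntegrable
  · exact (((hc.mul (hv.pow 2)).smul continuousOn_const).add
      ((continuousOn_const.mul ((hc.mul (hv.pow 2)).smul hR)).mul
        continuousOn_const)).intervalIntegrable

theorem quasiInverse_mem_range {𝒜 A : Type*} [AddCommGroup 𝒜] [Module ℂ 𝒜]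
    [NonUnitalRing A] [Module ℂ A] (ι : 𝒜 →ₗ[ℂ] A)
    (hmul : ∀ a b, ι a * ι b ∈ Set.range ι) (hmid : ∀ a x b, ι a * x * ι b ∈ Set.range ι)
    (f : 𝒜) (g : A) (h1 : ι f + g + ι f * g = 0) (h2 : ι f + g + g * ι f = 0) :
    g ∈ Set.range ι := by
  have e1 : g = -ι f - ι f * g := by
    rw [← sub_eq_zero, ← h1]; abel
  have e2 : g = -ι f - g * ι f := by
    rw [← sub_eq_zero, ← h2]; abel
  have e3 : g = -ι f + ι f * ι f + ι f * g * ι f := by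
    conv_lhs => rw [e1]
    conv_lhs => rw [e2]
    rw [mul_sub, mul_neg, mul_assoc]; abel
  obtain ⟨a, ha⟩ := hmul f f
  obtain ⟨c, hc⟩ := hmid f g f
  exact ⟨-f + a + c, by rw [map_add, map_add, map_neg, ha, hc, ← e3]⟩

end Stable

/-! ### Schwartz bounds from a representation of the Weyl algebra

A family `F f g` of functions whose partial derivatives and products with coordinates are sums of
members of the same family inherits Schwartz bounds from uniform bounds. -/

section Bootstrap

open scoped RealInnerProductSpace

variable {E : Type*} [NormedAddCommGroup E] [InnerProductSpace ℝ E] {ι : Type} [Fintype ι]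

theorem OrthonormalBasis.eq_sum_smulRight (b : OrthonormalBasis ι ℝ E) (L : E →L[ℝ] ℂ) :
    L = ∑ i, (innerSL ℝ (b i)).smulRight (L (b i)) := by
  ext v
  conv_lhs => rw [← b.sum_repr' v]
  simp [map_sum]

theorem OrthonormalBasis.norm_le_sum_abs_inner (b : OrthonormalBasis ι ℝ E) (x : E) :
    ‖x‖ ≤ ∑ i, |⟪b i, x⟫| := by
  conv_lhs => rw [← b.sum_repr' x]
  refine (norm_sum_le _ _).trans (Finset.sum_le_sum fun i _ => ?_)
  rw [norm_smul, b.norm_eq_one, mul_one, Real.norm_eq_abs]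

/-- The embedding of `ℂ` into the dual space as multiples of a fixed coordinate. -/
def coordSMul (b : OrthonormalBasis ι ℝ E) (i : ι) : ℂ →L[ℝ] (E →L[ℝ] ℂ) :=
  ContinuousLinearMap.smulRightL ℝ E ℂ (innerSL ℝ (b i))

theorem norm_coordSMul_le (b : OrthonormalBasis ι ℝ E) (i : ι) : ‖coordSMul b i‖ ≤ 1 := by
  refine ContinuousLinearMap.opNorm_le_bound _ zero_le_one fun z => ?_
  change ‖(innerSL ℝ (b i)).smulRight z‖ ≤ 1 * ‖z‖
  rw [ContinuousLinearMap.norm_smulRight_apply, innerSL_apply_norm, b.norm_eq_one]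

variable {𝒮 : Type*} [AddCommGroup 𝒮] [Module ℂ 𝒮] [TopologicalSpace 𝒮]
  {σ τ : Type} [Fintype σ] [Fintype τ]

/-- The functions `F f g` are differentiable, and the partial derivatives and coordinate multiples
of `F f g` are sums of functions `F (A f) (B g)`. -/
structure IsWeylStable (b : OrthonormalBasis ι ℝ E) (F : 𝒮 → 𝒮 → E → ℂ)
    (D : ι → σ → (𝒮 →L[ℂ] 𝒮) × (𝒮 →L[ℂ] 𝒮)) (X : ι → τ → (𝒮 →L[ℂ] 𝒮) × (𝒮 →L[ℂ] 𝒮)) : Prop where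
  differentiable : ∀ f g, Differentiable ℝ (F f g)
  fderiv_apply : ∀ f g x i, fderiv ℝ (F f g) x (b i) = ∑ s, F ((D i s).1 f) ((D i s).2 g) x
  inner_mul : ∀ f g x i, (⟪b i, x⟫ : ℂ) * F f g x = ∑ s, F ((X i s).1 f) ((X i s).2 g) x

variable {b : OrthonormalBasis ι ℝ E} {F : 𝒮 → 𝒮 → E → ℂ}
  {D : ι → σ → (𝒮 →L[ℂ] 𝒮) × (𝒮 →L[ℂ] 𝒮)} {X : ι → τ → (𝒮 →L[ℂ] 𝒮) × (𝒮 →L[ℂ] 𝒮)}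

theorem IsWeylStable.fderiv_eq (h : IsWeylStable b F D X) (f g : 𝒮) :
    fderiv ℝ (F f g) =
      fun x => ∑ p : ι × σ, coordSMul b p.1 (F ((D p.1 p.2).1 f) ((D p.1 p.2).2 g) x) := by
  ext1 x
  rw [b.eq_sum_smulRight (fderiv ℝ (F f g) x), Fintype.sum_prod_type]
  refine Finset.sum_congr rfl fun i _ => ?_
  rw [h.fderiv_apply]
  exact map_sum (coordSMul b i) _ _

theorem IsWeylStable.contDiff_nat (h : IsWeylStable b F D X) (n : ℕ) :
    ∀ f g, ContDiff ℝ n (F f g) := by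
  induction n with
  | zero => exact fun f g => contDiff_zero.2 (h.differentiable f g).continuous
  | succ n ih =>
    intro f g
    rw [Nat.cast_succ, contDiff_succ_iff_fderiv]
    refine ⟨h.differentiable f g, by simp, ?_⟩
    rw [h.fderiv_eq]
    exact ContDiff.sum fun p _ => (coordSMul b p.1).contDiff.comp (ih _ _)

theorem IsWeylStable.contDiff (h : IsWeylStable b F D X) (f g : 𝒮) : ContDiff ℝ ∞ (F f g) :=
  contDiff_infty.2 fun n => h.contDiff_nat n f g

/-- The index set and the operators `A` are chosen before `F` and `β`. Hence the same finite sum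
serves a whole family of `F`, which later makes the constants uniform in the middle factor of a
triple product. The coordinate rule trades powers of ‖x‖ and the derivative rule trades derivatives
for operators on f and g. -/
theorem exists_weyl_bound (b : OrthonormalBasis ι ℝ E)
    (D : ι → σ → (𝒮 →L[ℂ] 𝒮) × (𝒮 →L[ℂ] 𝒮)) (X : ι → τ → (𝒮 →L[ℂ] 𝒮) × (𝒮 →L[ℂ] 𝒮)) (k n : ℕ) :
    ∃ (κ : Type) (_ : Fintype κ) (A : κ → (𝒮 →L[ℂ] 𝒮) × (𝒮 →L[ℂ] 𝒮)),
      ∀ F : 𝒮 → 𝒮 → E → ℂ, IsWeylStable b F D X → ∀ β : 𝒮 → 𝒮 → ℝ,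
        (∀ f g x, ‖F f g x‖ ≤ β f g) → ∀ f g x,
          ‖x‖ ^ k * ‖iteratedFDeriv ℝ n (F f g) x‖ ≤ ∑ j, β ((A j).1 f) ((A j).2 g) := by
  induction n with
  | zero =>
    induction k with
    | zero =>
      refine ⟨Unit, inferInstance, fun _ => (.id ℂ 𝒮, .id ℂ 𝒮), fun F _ β hβ f g x => ?_⟩
      simpa using hβ f g x
    | succ k ih =>
      obtain ⟨κ, _, A, hA⟩ := ih
      refine ⟨(ι × τ) × κ, inferInstance, fun q => ((A q.2).1 ∘L (X q.1.1 q.1.2).1,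
        (A q.2).2 ∘L (X q.1.1 q.1.2).2), fun F hF β hβ f g x => ?_⟩
      rw [Fintype.sum_prod_type, norm_iteratedFDeriv_zero]
      calc ‖x‖ ^ (k + 1) * ‖F f g x‖ = ‖x‖ ^ k * ‖F f g x‖ * ‖x‖ := by ring
        _ ≤ ‖x‖ ^ k * ‖F f g x‖ * ∑ i, |⟪b i, x⟫| := by
            gcongr; exact b.norm_le_sum_abs_inner x
        _ = ∑ i, ‖x‖ ^ k * ‖(⟪b i, x⟫ : ℂ) * F f g x‖ := by
            rw [Finset.mul_sum]
            refine Finset.sum_congr rfl fun i _ => ?_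
            rw [norm_mul, Complex.norm_real, Real.norm_eq_abs]; ring
        _ ≤ ∑ i, ∑ s, ‖x‖ ^ k * ‖F ((X i s).1 f) ((X i s).2 g) x‖ := by
            refine Finset.sum_le_sum fun i _ => ?_
            rw [hF.inner_mul, ← Finset.mul_sum]
            gcongr
            exact norm_sum_le _ _
        _ = ∑ p : ι × τ, ‖x‖ ^ k * ‖F ((X p.1 p.2).1 f) ((X p.1 p.2).2 g) x‖ := by
            rw [Fintype.sum_prod_type]
        _ ≤ _ := by
            refine Finset.sum_le_sum fun p _ => ?_
            have := hA F hF β hβ ((X p.1 p.2).1 f) ((X p.1 p.2).2 g) x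
            rwa [norm_iteratedFDeriv_zero] at this
  | succ n ih =>
    obtain ⟨κ, _, A, hA⟩ := ih
    refine ⟨(ι × σ) × κ, inferInstance, fun q => ((A q.2).1 ∘L (D q.1.1 q.1.2).1,
      (A q.2).2 ∘L (D q.1.1 q.1.2).2), fun F hF β hβ f g x => ?_⟩
    rw [Fintype.sum_prod_type, ← norm_iteratedFDeriv_fderiv, hF.fderiv_eq, iteratedFDeriv_fun_sum_apply]
    · refine (mul_le_mul_of_nonneg_left (norm_sum_le _ _) (by positivity)).trans ?_
      rw [Finset.mul_sum]
      refine Finset.sum_le_sum fun p _ => ?_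
      refine le_trans ?_ (hA F hF β hβ ((D p.1 p.2).1 f) ((D p.1 p.2).2 g) x)
      refine mul_le_mul_of_nonneg_left ?_ (by positivity)
      have := (coordSMul b p.1).norm_iteratedFDeriv_comp_left (N := n) (n := n) (x := x)
        (hF.contDiff_nat n ((D p.1 p.2).1 f) ((D p.1 p.2).2 g)).contDiffAt le_rfl
      refine this.trans (mul_le_of_le_one_left (norm_nonneg _) (norm_coordSMul_le b p.1))
    · exact fun p _ => ((coordSMul b p.1).contDiff.comp (hF.contDiff_nat n _ _)).contDiffAt

end Bootstrap

/-! ### Twisted products of Schwartz functions -/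

section Twisted

open scoped RealInnerProductSpace

variable {E : Type*} [NormedAddCommGroup E] [InnerProductSpace ℝ E] [FiniteDimensional ℝ E]
  [MeasurableSpace E] [BorelSpace E]

/-- The integrand of the twisted superposition of the translates of `f`. -/
def twistIntegrand (K : E →L[ℝ] E) (φ f : 𝓢(E, ℂ)) (x w : E) : ℂ :=
  (Real.fourierChar ⟪w, x⟫ : ℂ) * φ w * f (x + K w)

/-- The twisted superposition `∫ e^{2πi⟨w,x⟩} φ(w) f(x + K w) dw` of translates of `f`. -/
def twist (K : E →L[ℝ] E) (φ f : 𝓢(E, ℂ)) (x : E) : ℂ :=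
  ∫ w, twistIntegrand K φ f x w

theorem norm_twistIntegrand (K : E →L[ℝ] E) (φ f : 𝓢(E, ℂ)) (x w : E) :
    ‖twistIntegrand K φ f x w‖ = ‖φ w‖ * ‖f (x + K w)‖ := by
  rw [twistIntegrand, norm_mul, norm_mul, Circle.norm_coe, one_mul]

theorem continuous_fourierChar_coe : Continuous fun r : ℝ => (Real.fourierChar r : ℂ) :=
  continuous_subtype_val.comp Real.continuous_fourierChar

theorem continuous_twistIntegrand (K : E →L[ℝ] E) (φ f : 𝓢(E, ℂ)) (x : E) :
    Continuous (twistIntegrand K φ f x) := by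
  have h1 := φ.continuous
  have h2 := f.continuous
  have h3 := continuous_fourierChar_coe
  unfold twistIntegrand
  fun_prop

theorem integrable_twistIntegrand (K : E →L[ℝ] E) (φ f : 𝓢(E, ℂ)) (x : E) :
    Integrable (twistIntegrand K φ f x) := by
  refine (φ.integrable.norm.mul_const (SchwartzMap.seminorm ℝ 0 0 f)).mono'
    (continuous_twistIntegrand K φ f x).aestronglyMeasurable (Eventually.of_forall fun w => ?_)
  rw [norm_twistIntegrand]
  gcongr
  exact norm_le_seminorm ℝ f _

theorem norm_twist_le (K : E →L[ℝ] E) (φ f : 𝓢(E, ℂ)) (x : E) :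
    ‖twist K φ f x‖ ≤ (∫ w, ‖φ w‖) * SchwartzMap.seminorm ℝ 0 0 f := by
  rw [twist, ← integral_mul_const]
  refine norm_integral_le_of_norm_le (φ.integrable.norm.mul_const _)
    (Eventually.of_forall fun w => ?_)
  rw [norm_twistIntegrand]
  gcongr
  exact norm_le_seminorm ℝ f _

theorem twist_add_left (K : E →L[ℝ] E) (φ ψ f : 𝓢(E, ℂ)) (x : E) :
    twist K (φ + ψ) f x = twist K φ f x + twist K ψ f x := by
  rw [twist, twist, twist, ← integral_add (integrable_twistIntegrand K φ f x)
    (integrable_twistIntegrand K ψ f x)]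
  congr 1 with w
  simp only [twistIntegrand, _root_.add_apply]
  ring

theorem twist_add_right (K : E →L[ℝ] E) (φ f g : 𝓢(E, ℂ)) (x : E) :
    twist K φ (f + g) x = twist K φ f x + twist K φ g x := by
  rw [twist, twist, twist, ← integral_add (integrable_twistIntegrand K φ f x)
    (integrable_twistIntegrand K φ g x)]
  congr 1 with w
  simp only [twistIntegrand, _root_.add_apply]
  ring

theorem twist_smul_left (K : E →L[ℝ] E) (c : ℂ) (φ f : 𝓢(E, ℂ)) (x : E) :
    twist K (c • φ) f x = c * twist K φ f x := by
  rw [twist, twist, ← integral_const_mul]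
  congr 1 with w
  simp only [twistIntegrand, _root_.smul_apply, smul_eq_mul]
  ring

theorem twist_smul_right (K : E →L[ℝ] E) (c : ℂ) (φ f : 𝓢(E, ℂ)) (x : E) :
    twist K φ (c • f) x = c * twist K φ f x := by
  rw [twist, twist, ← integral_const_mul]
  congr 1 with w
  simp only [twistIntegrand, _root_.smul_apply, smul_eq_mul]
  ring

/-- A continuous linear map is skew if it is minus its own transpose. -/
def IsSkew (K : E →L[ℝ] E) : Prop := ∀ v w, ⟪K v, w⟫ = -⟪v, K w⟫

theorem IsSkew.neg {K : E →L[ℝ] E} (hK : IsSkew K) : IsSkew (-K) := fun v w => by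
  simp [hK v w]

theorem IsSkew.inner_self {K : E →L[ℝ] E} (hK : IsSkew K) (v : E) : ⟪v, K v⟫ = 0 := by
  have := hK v v
  rw [real_inner_comm] at this
  linarith

theorem apply_eq_integral_fourier (f : 𝓢(E, ℂ)) (x : E) :
    f x = ∫ v, (Real.fourierChar ⟪v, x⟫ : ℂ) * 𝓕 f v := by
  have h : 𝓕⁻ (𝓕 f) = f := FourierTransform.fourierInv_fourier_eq f
  conv_lhs => rw [← h, fourierInv_coe, Real.fourierInv_eq]
  rfl

/-- Expanding both functions by Fourier inversion gives the same double integral; the phases agree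
because ⟨v, Kw⟩ = ⟨w, -Kv⟩. -/
theorem twist_fourier_comm {K : E →L[ℝ] E} (hK : IsSkew K) (f g : 𝓢(E, ℂ)) (x : E) :
    twist K (𝓕 g) f x = twist (-K) (𝓕 f) g x := by
  have h1 : ∀ w, twistIntegrand K (𝓕 g) f x w = ∫ v, (Real.fourierChar ⟪w, x⟫ : ℂ) * 𝓕 g w *
      ((Real.fourierChar ⟪v, x + K w⟫ : ℂ) * 𝓕 f v) := fun w => by
    rw [integral_const_mul, ← apply_eq_integral_fourier]; rfl
  have h2 : ∀ v, twistIntegrand (-K) (𝓕 f) g x v = ∫ w, (Real.fourierChar ⟪w, x⟫ : ℂ) * 𝓕 g w *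
      ((Real.fourierChar ⟪v, x + K w⟫ : ℂ) * 𝓕 f v) := fun v => by
    rw [twistIntegrand, apply_eq_integral_fourier g, ← integral_const_mul]
    congr 1 with w
    have e : (Real.fourierChar ⟪v, x⟫ : ℂ) * Real.fourierChar ⟪w, x + (-K) v⟫ =
        Real.fourierChar ⟪w, x⟫ * Real.fourierChar ⟪v, x + K w⟫ := by
      rw [← Circle.coe_mul, ← Circle.coe_mul, ← AddChar.map_add_eq_mul, ← AddChar.map_add_eq_mul]
      congr 2
      rw [inner_add_right, inner_add_right, _root_.neg_apply, inner_neg_right,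
        real_inner_comm (K v) w, hK v w]
      ring
    linear_combination (𝓕 f v * 𝓕 g w) * e
  simp only [twist, h1, h2]
  rw [integral_integral_swap]
  have h3 := (𝓕 g).continuous
  have h4 := (𝓕 f).continuous
  have h5 := continuous_fourierChar_coe
  refine ((𝓕 g).integrable.mul_prod (𝓕 f).integrable).mono
    (Continuous.aestronglyMeasurable ?_) (Eventually.of_forall fun p => ?_)
  · unfold Function.uncurry; fun_prop
  · simp only [Function.uncurry, norm_mul, Circle.norm_coe, one_mul, le_refl]

/-- Associativity in disguise: with φ, ψ the Fourier transforms of the outer factors, left and right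
multiplication of g commute. Both orders superpose g(x - Kw + Kv) with weights φ(w)ψ(v), and
skewness matches the phases. -/
theorem twist_twist_comm {K : E →L[ℝ] E} (hK : IsSkew K) (φ ψ g G H : 𝓢(E, ℂ))
    (hG : ∀ x, G x = twist K ψ g x) (hH : ∀ x, H x = twist (-K) φ g x) (x : E) :
    twist (-K) φ G x = twist K ψ H x := by
  have h1 : ∀ w, twistIntegrand (-K) φ G x w = ∫ v, (Real.fourierChar ⟪w, x⟫ : ℂ) * φ w *
      ((Real.fourierChar ⟪v, x - K w⟫ : ℂ) * ψ v * g (x - K w + K v)) := fun w => by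
    rw [integral_const_mul, twistIntegrand, hG, _root_.neg_apply, ← sub_eq_add_neg]
    rfl
  have h2 : ∀ v, twistIntegrand K ψ H x v = ∫ w, (Real.fourierChar ⟪w, x⟫ : ℂ) * φ w *
      ((Real.fourierChar ⟪v, x - K w⟫ : ℂ) * ψ v * g (x - K w + K v)) := fun v => by
    rw [twistIntegrand, hH, twist, ← integral_const_mul]
    congr 1 with w
    have e : (Real.fourierChar ⟪v, x⟫ : ℂ) * Real.fourierChar ⟪w, x + K v⟫ =
        Real.fourierChar ⟪w, x⟫ * Real.fourierChar ⟪v, x - K w⟫ := by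
      rw [← Circle.coe_mul, ← Circle.coe_mul, ← AddChar.map_add_eq_mul, ← AddChar.map_add_eq_mul]
      congr 2
      rw [inner_add_right, inner_sub_right, real_inner_comm (K v) w, hK v w]
      ring
    have e2 : x + K v + (-K) w = x - K w + K v := by rw [_root_.neg_apply]; abel
    rw [twistIntegrand, e2]
    linear_combination (φ w * ψ v * g (x - K w + K v)) * e
  simp only [twist, h1, h2]
  rw [integral_integral_swap]
  have h3 := φ.continuous
  have h4 := ψ.continuous
  have h6 := g.continuous
  have h5 := continuous_fourierChar_coe
  refine ((φ.integrable.norm.mul_prod ψ.integrable.norm).mul_const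
    (SchwartzMap.seminorm ℝ 0 0 g)).mono'
    (Continuous.aestronglyMeasurable ?_) (Eventually.of_forall fun p => ?_)
  · unfold Function.uncurry; fun_prop
  · simp only [Function.uncurry, norm_mul, Circle.norm_coe, one_mul, mul_one, ← mul_assoc]
    exact mul_le_mul_of_nonneg_left (norm_le_seminorm ℝ g _) (by positivity)

/-- The derivative of the integrand of `twist`. -/
def twistIntegrandDeriv (K : E →L[ℝ] E) (φ f : 𝓢(E, ℂ)) (x w : E) : E →L[ℝ] ℂ :=
  ((Real.fourierChar ⟪w, x⟫ : ℂ) * φ w) • fderiv ℝ f (x + K w) +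
    (2 * Real.pi * Complex.I * twistIntegrand K φ f x w) • Complex.ofRealCLM.comp (innerSL ℝ w)

theorem hasFDerivAt_twistIntegrand (K : E →L[ℝ] E) (φ f : 𝓢(E, ℂ)) (x w : E) :
    HasFDerivAt (fun x => twistIntegrand K φ f x w) (twistIntegrandDeriv K φ f x w) x := by
  have h1 : HasFDerivAt (fun x => (Real.fourierChar ⟪w, x⟫ : ℂ))
      ((innerSL ℝ w).smulRight (2 * Real.pi * Complex.I * (Real.fourierChar ⟪w, x⟫ : ℂ))) x :=
    (Real.hasDerivAt_fourierChar ⟪w, x⟫).hasFDerivAt.comp x (innerSL ℝ w).hasFDerivAt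
  have h2 : HasFDerivAt (fun x => f (x + K w)) (fderiv ℝ f (x + K w)) x :=
    by
    simpa [Function.comp_def] using (f.hasFDerivAt (x + K w)).comp x ((hasFDerivAt_id x).add_const (K w))
  refine ((h1.mul_const (φ w)).mul h2).congr_fderiv ?_
  ext v
  simp [twistIntegrandDeriv, twistIntegrand]
  ring

theorem norm_twistIntegrandDeriv_le (K : E →L[ℝ] E) (φ f : 𝓢(E, ℂ)) (x w : E) :
    ‖twistIntegrandDeriv K φ f x w‖ ≤ ‖φ w‖ * SchwartzMap.seminorm ℝ 0 1 f +
      2 * Real.pi * SchwartzMap.seminorm ℝ 0 0 f * (‖w‖ ^ 1 * ‖φ w‖) := by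
  refine (norm_add_le _ _).trans (add_le_add ?_ ?_)
  · rw [norm_smul, norm_mul, Circle.norm_coe, one_mul]
    gcongr
    rw [← norm_iteratedFDeriv_one]
    exact norm_iteratedFDeriv_le_seminorm ℝ f 1 _
  · rw [norm_smul, norm_mul, norm_twistIntegrand]
    have h1 : ‖Complex.ofRealCLM.comp (innerSL ℝ w)‖ ≤ ‖w‖ := by
      refine (ContinuousLinearMap.opNorm_comp_le _ _).trans ?_
      rw [Complex.ofRealCLM_norm, one_mul, innerSL_apply_norm]
    have h2 : ‖(2 * Real.pi * Complex.I : ℂ)‖ = 2 * Real.pi := by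
      simp [Real.pi_pos.le]
    rw [h2]
    calc 2 * Real.pi * (‖φ w‖ * ‖f (x + K w)‖) * ‖Complex.ofRealCLM.comp (innerSL ℝ w)‖
        ≤ 2 * Real.pi * (‖φ w‖ * SchwartzMap.seminorm ℝ 0 0 f) * ‖w‖ := by
          have := Real.pi_pos
          gcongr
          exact norm_le_seminorm ℝ f _
      _ = _ := by ring

theorem continuous_twistIntegrandDeriv (K : E →L[ℝ] E) (φ f : 𝓢(E, ℂ)) (x : E) :
    Continuous (twistIntegrandDeriv K φ f x) := by
  have h1 := φ.continuous
  have h2 : Continuous (fderiv ℝ f) := (fderivCLM ℝ E ℂ f).continuous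
  have h3 := continuous_fourierChar_coe
  have h4 := continuous_twistIntegrand K φ f x
  unfold twistIntegrandDeriv
  fun_prop

theorem integrable_twistIntegrandDeriv_bound (φ f : 𝓢(E, ℂ)) :
    Integrable fun w => ‖φ w‖ * SchwartzMap.seminorm ℝ 0 1 f +
      2 * Real.pi * SchwartzMap.seminorm ℝ 0 0 f * (‖w‖ ^ 1 * ‖φ w‖) :=
  (φ.integrable.norm.mul_const _).add ((integrable_pow_mul volume φ 1).const_mul _)

theorem integrable_twistIntegrandDeriv (K : E →L[ℝ] E) (φ f : 𝓢(E, ℂ)) (x : E) :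
    Integrable (twistIntegrandDeriv K φ f x) :=
  (integrable_twistIntegrandDeriv_bound φ f).mono'
    (continuous_twistIntegrandDeriv K φ f x).aestronglyMeasurable
    (Eventually.of_forall fun w => norm_twistIntegrandDeriv_le K φ f x w)

theorem hasFDerivAt_twist (K : E →L[ℝ] E) (φ f : 𝓢(E, ℂ)) (x : E) :
    HasFDerivAt (twist K φ f) (∫ w, twistIntegrandDeriv K φ f x w) x :=
  hasFDerivAt_integral_of_dominated_of_fderiv_le (s := Set.univ) univ_mem
    (Eventually.of_forall fun y => (continuous_twistIntegrand K φ f y).aestronglyMeasurable)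
    (integrable_twistIntegrand K φ f x)
    (continuous_twistIntegrandDeriv K φ f x).aestronglyMeasurable
    (Eventually.of_forall fun w y _ => norm_twistIntegrandDeriv_le K φ f y w)
    (integrable_twistIntegrandDeriv_bound φ f)
    (Eventually.of_forall fun w y _ => hasFDerivAt_twistIntegrand K φ f y w)

/-- Multiplication of Schwartz functions by the linear function `⟨·, v⟩`. -/
def mulInner (v : E) : 𝓢(E, ℂ) →L[ℂ] 𝓢(E, ℂ) := smulLeftCLM ℂ fun x => ((⟪x, v⟫ : ℝ) : ℂ)

theorem mulInner_apply (v : E) (f : 𝓢(E, ℂ)) (x : E) : mulInner v f x = (⟪x, v⟫ : ℂ) * f x := by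
  have : (inner ℝ · v : E → ℝ).HasTemperateGrowth := by fun_prop
  have h := congrArg (fun g : 𝓢(E, ℂ) => g x) (smulLeftCLM_ofReal ℂ this f)
  refine h.trans ?_
  rw [smulLeftCLM_apply_apply this, Complex.real_smul]

/-- The directional derivative of Schwartz functions. -/
def dirDeriv (v : E) : 𝓢(E, ℂ) →L[ℂ] 𝓢(E, ℂ) := LineDeriv.lineDerivOpCLM ℂ 𝓢(E, ℂ) v

theorem dirDeriv_apply (v : E) (f : 𝓢(E, ℂ)) (x : E) : dirDeriv v f x = fderiv ℝ f x v := rfl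

theorem fourier_dirDeriv (v : E) (f : 𝓢(E, ℂ)) :
    𝓕 (dirDeriv v f) = (2 * Real.pi * Complex.I) • mulInner v (𝓕 f) :=
by
  have : (inner ℝ · v : E → ℝ).HasTemperateGrowth := by fun_prop
  refine (fourier_lineDerivOp_eq f v).trans ?_
  rw [← smulLeftCLM_ofReal ℂ this]
  rfl

/-- The derivative hits either the translate of f or the character, which produces the factor
2πi⟨w,v⟩. For φ = ĝ the latter is a derivative of g, so this is the Leibniz rule. -/
theorem fderiv_twist_apply (K : E →L[ℝ] E) (φ f : 𝓢(E, ℂ)) (x v : E) :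
    fderiv ℝ (twist K φ f) x v =
      twist K φ (dirDeriv v f) x + twist K ((2 * Real.pi * Complex.I) • mulInner v φ) f x := by
  rw [(hasFDerivAt_twist K φ f x).fderiv, ContinuousLinearMap.integral_apply
    (integrable_twistIntegrandDeriv K φ f x), twist, twist,
    ← integral_add (integrable_twistIntegrand ..) (integrable_twistIntegrand ..)]
  congr 1 with w
  simp only [twistIntegrand, twistIntegrandDeriv, dirDeriv_apply, _root_.smul_apply, mulInner_apply,
    _root_.add_apply, smul_eq_mul, ContinuousLinearMap.comp_apply, Complex.ofRealCLM_apply,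
    innerSL_apply_apply]
  ring

/-- Write x = (x + Kw) - Kw: the first part is absorbed by f, the second by φ after moving K across
the inner product. -/
theorem inner_mul_twist {K : E →L[ℝ] E} (hK : IsSkew K) (φ f : 𝓢(E, ℂ)) (x v : E) :
    (⟪v, x⟫ : ℂ) * twist K φ f x = twist K φ (mulInner v f) x + twist K (mulInner (K v) φ) f x := by
  rw [twist, twist, twist, ← integral_const_mul,
    ← integral_add (integrable_twistIntegrand ..) (integrable_twistIntegrand ..)]
  congr 1 with w
  have e : (⟪v, x⟫ : ℂ) = ⟪x + K w, v⟫ + ⟪w, K v⟫ := by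
    rw [← Complex.ofReal_add, inner_add_left, hK w v, real_inner_comm]
    ring_nf
  simp only [twistIntegrand, mulInner_apply, e]
  ring

end Twisted

/-! ### The twisted product as a continuous associative product on Schwartz space -/

section WeylMul

open scoped RealInnerProductSpace

variable {E : Type*} [NormedAddCommGroup E] [InnerProductSpace ℝ E] [FiniteDimensional ℝ E]
  [MeasurableSpace E] [BorelSpace E]

/-- Directional derivatives of twisted products, by the Leibniz rule. -/
def weylDeriv {ι : Type} [Fintype ι] (b : OrthonormalBasis ι ℝ E) (i : ι) (s : Bool) :
    (𝓢(E, ℂ) →L[ℂ] 𝓢(E, ℂ)) × (𝓢(E, ℂ) →L[ℂ] 𝓢(E, ℂ)) :=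
  if s then (dirDeriv (b i), .id ℂ _) else (.id ℂ _, dirDeriv (b i))

/-- Coordinate multiples of twisted products. -/
def weylCoord {ι : Type} [Fintype ι] (b : OrthonormalBasis ι ℝ E) (K : E →L[ℝ] E) (i : ι)
    (s : Bool) : (𝓢(E, ℂ) →L[ℂ] 𝓢(E, ℂ)) × (𝓢(E, ℂ) →L[ℂ] 𝓢(E, ℂ)) :=
  if s then (mulInner (b i), .id ℂ _)
  else (.id ℂ _, (2 * Real.pi * Complex.I)⁻¹ • dirDeriv (K (b i)))

theorem two_pi_I_ne_zero : (2 * Real.pi * Complex.I : ℂ) ≠ 0 := Complex.two_pi_I_ne_zero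

theorem fourier_inv_smul_dirDeriv (v : E) (f : 𝓢(E, ℂ)) :
    𝓕 ((2 * Real.pi * Complex.I : ℂ)⁻¹ • dirDeriv v f) = mulInner v (𝓕 f) := by
  rw [FourierTransform.fourier_smul, fourier_dirDeriv, inv_smul_smul₀ two_pi_I_ne_zero]

theorem fderiv_twist_fourier (K : E →L[ℝ] E) (f g : 𝓢(E, ℂ)) (x v : E) :
    fderiv ℝ (twist K (𝓕 g) f) x v =
      twist K (𝓕 g) (dirDeriv v f) x + twist K (𝓕 (dirDeriv v g)) f x := by
  rw [fderiv_twist_apply, fourier_dirDeriv]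

theorem inner_mul_twist_fourier {K : E →L[ℝ] E} (hK : IsSkew K) (f g : 𝓢(E, ℂ)) (x v : E) :
    (⟪v, x⟫ : ℂ) * twist K (𝓕 g) f x = twist K (𝓕 g) (mulInner v f) x +
      twist K (𝓕 ((2 * Real.pi * Complex.I : ℂ)⁻¹ • dirDeriv (K v) g)) f x := by
  rw [inner_mul_twist hK, fourier_inv_smul_dirDeriv]

theorem isWeylStable_twist {ι : Type} [Fintype ι] (b : OrthonormalBasis ι ℝ E) {K : E →L[ℝ] E}
    (hK : IsSkew K) :
    IsWeylStable b (fun f g : 𝓢(E, ℂ) => twist K (𝓕 g) f) (weylDeriv b) (weylCoord b K) where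
  differentiable f g x := (hasFDerivAt_twist K (𝓕 g) f x).differentiableAt
  fderiv_apply f g x i := by
    simp [fderiv_twist_fourier, weylDeriv]
  inner_mul f g x i := by
    simp [inner_mul_twist_fourier hK, weylCoord]

/-- The twisted product of two Schwartz functions as a Schwartz function. -/
def weylMulFun {K : E →L[ℝ] E} (hK : IsSkew K) (f g : 𝓢(E, ℂ)) : 𝓢(E, ℂ) where
  toFun := twist K (𝓕 g) f
  smooth' := (isWeylStable_twist (stdOrthonormalBasis ℝ E) hK).contDiff f g
  decay' k n := by
    obtain ⟨κ, _, A, hA⟩ := exists_weyl_bound (stdOrthonormalBasis ℝ E)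
      (weylDeriv (stdOrthonormalBasis ℝ E)) (weylCoord (stdOrthonormalBasis ℝ E) K) k n
    exact ⟨_, hA _ (isWeylStable_twist _ hK) (fun f g => (∫ w, ‖𝓕 g w‖) *
      SchwartzMap.seminorm ℝ 0 0 f) (fun f g x => norm_twist_le K (𝓕 g) f x) f g⟩

/-- The twisted product as a bilinear map on the Schwartz space. -/
def weylMul {K : E →L[ℝ] E} (hK : IsSkew K) : 𝓢(E, ℂ) →ₗ[ℂ] 𝓢(E, ℂ) →ₗ[ℂ] 𝓢(E, ℂ) :=
  LinearMap.mk₂ ℂ (weylMulFun hK)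
    (fun f₁ f₂ g => by ext x; exact twist_add_right K _ f₁ f₂ x)
    (fun c f g => by ext x; exact twist_smul_right K c _ f x)
    (fun f g₁ g₂ => by
      ext x
      change twist K (𝓕 (g₁ + g₂)) f x = _
      rw [FourierTransform.fourier_add]; exact twist_add_left K _ _ f x)
    (fun c f g => by
      ext x
      change twist K (𝓕 (c • g)) f x = _
      rw [FourierTransform.fourier_smul]; exact twist_smul_left K c _ f x)

theorem weylMul_apply {K : E →L[ℝ] E} (hK : IsSkew K) (f g : 𝓢(E, ℂ)) (x : E) :
    weylMul hK f g x = twist K (𝓕 g) f x := rfl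

theorem weylMul_apply' {K : E →L[ℝ] E} (hK : IsSkew K) (f g : 𝓢(E, ℂ)) (x : E) :
    weylMul hK f g x = twist (-K) (𝓕 f) g x := twist_fourier_comm hK f g x

theorem weylMul_comm {K : E →L[ℝ] E} (hK : IsSkew K) (f g : 𝓢(E, ℂ)) :
    weylMul hK f g = weylMul hK.neg g f := by
  ext x; exact twist_fourier_comm hK f g x

theorem weylMul_assoc {K : E →L[ℝ] E} (hK : IsSkew K) (f g h : 𝓢(E, ℂ)) :
    weylMul hK (weylMul hK f g) h = weylMul hK f (weylMul hK g h) := by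
  ext x
  rw [weylMul_apply, weylMul_apply']
  exact (twist_twist_comm hK (𝓕 f) (𝓕 h) g _ _ (fun x => rfl) (weylMul_apply' hK f g) x).symm

theorem fourier_conj (f f' : 𝓢(E, ℂ)) (hf : ∀ x, f' x = conj (f x)) (w : E) :
    𝓕 f' w = conj (𝓕 f (-w)) := by
  rw [fourier_coe, fourier_coe, Real.fourier_eq, Real.fourier_eq, ← integral_conj]
  congr 1 with v
  simp only [hf, Circle.smul_def, smul_eq_mul, map_mul, inner_neg_right, neg_neg,
    ← Circle.coe_inv_eq_conj, ← AddChar.map_neg_eq_inv]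

/-- Conjugating the integrand and substituting w ↦ -w replaces K by -K, and the exchange of factors
turns this back into K with the order reversed. -/
theorem conj_weylMul {K : E →L[ℝ] E} (hK : IsSkew K) (f g f' g' : 𝓢(E, ℂ))
    (hf : ∀ x, f' x = conj (f x)) (hg : ∀ x, g' x = conj (g x)) (x : E) :
    conj (weylMul hK f g x) = weylMul hK g' f' x := by
  rw [weylMul_apply' hK g' f', weylMul_apply, twist, twist, ← integral_conj,
    ← integral_neg_eq_self (μ := volume) (twistIntegrand (-K) (𝓕 g') f' x)]
  congr 1 with w
  simp only [twistIntegrand, fourier_conj g g' hg, hf, map_mul, ← Circle.coe_inv_eq_conj,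
    ← AddChar.map_neg_eq_inv, inner_neg_left, neg_neg, _root_.neg_apply, map_neg]

/-- The bound of the supremum norm of a twisted product. -/
def weylBound (f g : 𝓢(E, ℂ)) : ℝ := ‖(𝓕 g).toLp 1 (volume : Measure E)‖ *
  SchwartzMap.seminorm ℝ 0 0 f

theorem norm_weylMul_apply_le {K : E →L[ℝ] E} (hK : IsSkew K) (f g : 𝓢(E, ℂ)) (x : E) :
    ‖weylMul hK f g x‖ ≤ weylBound f g := by
  rw [weylBound, norm_toLp_one]
  exact norm_twist_le K (𝓕 g) f x

theorem continuous_norm_fourier_toLp_one :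
    Continuous fun f : 𝓢(E, ℂ) => ‖(𝓕 f).toLp 1 (volume : Measure E)‖ :=
  ((toLpCLM ℂ ℂ 1 (volume : Measure E)).continuous.comp
    (FourierTransform.fourierCLM ℂ 𝓢(E, ℂ)).continuous).norm

theorem continuous_weylBound_comp {X : Type*} [TopologicalSpace X] {u v : X → 𝓢(E, ℂ)}
    (hu : Continuous u) (hv : Continuous v) : Continuous fun x => weylBound (u x) (v x) := by
  have h1 : Continuous fun x => SchwartzMap.seminorm ℝ 0 0 (u x) :=
    (continuous_schwartz_seminorm 0 0).comp hu
  have h2 : Continuous fun x => ‖(𝓕 (v x)).toLp 1 (volume : Measure E)‖ :=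
    continuous_norm_fourier_toLp_one.comp hv
  exact h2.mul h1

theorem exists_seminorm_weylMul_le {K : E →L[ℝ] E} (hK : IsSkew K) (k n : ℕ) :
    ∃ (κ : Type) (_ : Fintype κ) (A : κ → (𝓢(E, ℂ) →L[ℂ] 𝓢(E, ℂ)) × (𝓢(E, ℂ) →L[ℂ] 𝓢(E, ℂ))),
      ∀ f g : 𝓢(E, ℂ), SchwartzMap.seminorm ℝ k n (weylMul hK f g) ≤
        ∑ j, weylBound ((A j).1 f) ((A j).2 g) := by
  obtain ⟨κ, hκ, A, hA⟩ := exists_weyl_bound (stdOrthonormalBasis ℝ E)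
    (weylDeriv (stdOrthonormalBasis ℝ E)) (weylCoord (stdOrthonormalBasis ℝ E) K) k n
  refine ⟨κ, hκ, A, fun f g => ?_⟩
  have := hA _ (isWeylStable_twist _ hK) weylBound (norm_weylMul_apply_le hK) f g
  exact SchwartzMap.seminorm_le_bound ℝ k n _ (le_trans (by positivity) (this 0)) this

theorem weylBound_zero_left (g : 𝓢(E, ℂ)) : weylBound 0 g = 0 := by
  rw [weylBound, map_zero, mul_zero]

theorem weylBound_zero_right (f : 𝓢(E, ℂ)) : weylBound f 0 = 0 := by
  rw [weylBound, FourierTransform.fourier_zero, ← toLpCLM_apply (𝕜 := ℂ), map_zero, norm_zero, zero_mul]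

theorem continuous_weylMul {K : E →L[ℝ] E} (hK : IsSkew K) :
    Continuous fun p : 𝓢(E, ℂ) × 𝓢(E, ℂ) => weylMul hK p.1 p.2 := by
  rw [continuous_iff_continuousAt]
  rintro ⟨f₀, g₀⟩
  refine ((schwartz_withSeminorms ℝ E ℂ).tendsto_nhds _ _).2 ?_
  rintro ⟨k, n⟩ ε hε
  obtain ⟨κ, _, A, hb⟩ := exists_seminorm_weylMul_le hK k n
  -- A continuous majorant of the seminorm of f ⋆ g - f₀ ⋆ g₀ = (f - f₀) ⋆ g + f₀ ⋆ (g - g₀) that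
  -- vanishes at (f₀, g₀).
  let Ψ : 𝓢(E, ℂ) × 𝓢(E, ℂ) → ℝ := fun p => ∑ j, weylBound ((A j).1 (p.1 - f₀)) ((A j).2 p.2) +
    ∑ j, weylBound ((A j).1 f₀) ((A j).2 (p.2 - g₀))
  have hΨ : Continuous Ψ := by
    refine (continuous_finsetSum _ fun j _ => ?_).add (continuous_finsetSum _ fun j _ => ?_)
    · exact continuous_weylBound_comp ((A j).1.continuous.comp
        (continuous_fst.sub continuous_const)) ((A j).2.continuous.comp continuous_snd)
    · exact continuous_weylBound_comp continuous_const
        ((A j).2.continuous.comp (continuous_snd.sub continuous_const))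
  have hΨ0 : Ψ (f₀, g₀) = 0 := by
    simp only [Ψ, sub_self, map_zero, weylBound_zero_left, weylBound_zero_right,
      Finset.sum_const_zero, add_zero]
  have hlt := hΨ.continuousAt.eventually (gt_mem_nhds (hΨ0.trans_lt hε))
  filter_upwards [hlt] with p hp
  refine lt_of_le_of_lt ?_ hp
  have : weylMul hK p.1 p.2 - weylMul hK f₀ g₀ =
      weylMul hK (p.1 - f₀) p.2 + weylMul hK f₀ (p.2 - g₀) := by
    rw [map_sub, LinearMap.sub_apply, map_sub]; abel
  change SchwartzMap.seminorm ℝ k n (weylMul hK p.1 p.2 - weylMul hK f₀ g₀) ≤ _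
  rw [this]
  exact (map_add_le_add _ _ _).trans (add_le_add (hb _ _) (hb _ _))

end WeylMul

/-! ### Square-integrable bounds for twisted products -/

section LTwo

open scoped RealInnerProductSpace

/-- The Cauchy–Schwarz inequality for a pointwise nonnegative quadratic form. -/
theorem sq_integral_le_of_quadratic {X : Type*} [MeasurableSpace X] {μ : Measure X}
    {p q r : X → ℝ} (hp : Integrable p μ) (hq : Integrable q μ) (hr : Integrable r μ)
    (h : ∀ t x, 0 ≤ r x * (t * t) + (-2 * q x) * t + p x) :
    (∫ x, q x ∂μ) ^ 2 ≤ (∫ x, p x ∂μ) * ∫ x, r x ∂μ := by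
  have key : ∀ t : ℝ, 0 ≤ (∫ x, r x ∂μ) * (t * t) + (-2 * ∫ x, q x ∂μ) * t + ∫ x, p x ∂μ := by
    intro t
    rw [← integral_const_mul, ← integral_mul_const, ← integral_mul_const,
      ← integral_add (hr.mul_const _) ((hq.const_mul _).mul_const _), ← integral_add _ hp]
    · exact integral_nonneg (h t)
    · exact (hr.mul_const _).add ((hq.const_mul _).mul_const _)
  have := discrim_le_zero key
  rw [discrim] at this
  linarith

variable {E : Type*} [NormedAddCommGroup E] [InnerProductSpace ℝ E] [FiniteDimensional ℝ E]
  [MeasurableSpace E] [BorelSpace E]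

theorem integrable_shear {𝕜 : Type*} [RCLike 𝕜] (K : E →L[ℝ] E) {φ g : E → 𝕜}
    (hφ : Integrable φ) (hg : Integrable g) (hφc : Continuous φ) (hgc : Continuous g) :
    Integrable (fun p : E × E => φ p.1 * g (p.2 + K p.1)) (volume.prod volume) := by
  rw [integrable_prod_iff (Continuous.aestronglyMeasurable (by fun_prop))]
  refine ⟨Eventually.of_forall fun w => (hg.comp_add_right (K w)).const_mul (φ w), ?_⟩
  have : ∀ w, ∫ y, ‖φ w * g (y + K w)‖ = ‖φ w‖ * ∫ y, ‖g y‖ := fun w => by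
    simp only [norm_mul]
    rw [integral_const_mul, integral_add_right_eq_self fun y => ‖g y‖]
  simp only [this]
  exact hφ.norm.mul_const _

theorem integrable_norm_sq (f : 𝓢(E, ℂ)) : Integrable fun x => ‖f x‖ ^ 2 :=
  (memLp_two_iff_integrable_sq_norm f.continuous.aestronglyMeasurable).1 (f.memLp 2)

theorem norm_toLp_two_sq (f : 𝓢(E, ℂ)) :
    ‖f.toLp 2 (volume : Measure E)‖ ^ 2 = ∫ x, ‖f x‖ ^ 2 := by
  have h := inner_toL2_toL2_eq f f (volume : Measure E)
  have h2 : ∀ x, inner ℂ (f x) (f x) = ((‖f x‖ ^ 2 : ℝ) : ℂ) := fun x => by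
    rw [inner_self_eq_norm_sq_to_K]; norm_cast
  rw [inner_self_eq_norm_sq_to_K] at h
  simp only [h2] at h
  rw [integral_complex_ofReal] at h
  exact Complex.ofReal_injective ((Complex.ofReal_pow _ _).trans h)

theorem sq_norm_twist_le (K : E →L[ℝ] E) (φ g : 𝓢(E, ℂ)) (x : E) :
    ‖twist K φ g x‖ ^ 2 ≤ (∫ w, ‖φ w‖) * ∫ w, ‖φ w‖ * ‖g (x + K w)‖ ^ 2 := by
  have hb : ∀ m : ℕ, Integrable fun w => ‖φ w‖ * ‖g (x + K w)‖ ^ m := fun m => by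
    refine (φ.integrable.norm.mul_const (SchwartzMap.seminorm ℝ 0 0 g ^ m)).mono'
      (Continuous.aestronglyMeasurable ?_) (Eventually.of_forall fun w => ?_)
    · have h1 := φ.continuous
      have h2 := g.continuous
      fun_prop
    · rw [Real.norm_of_nonneg (by positivity)]
      gcongr
      exact norm_le_seminorm ℝ g _
  have h1 : ‖twist K φ g x‖ ≤ ∫ w, ‖φ w‖ * ‖g (x + K w)‖ := by
    refine (norm_integral_le_integral_norm _).trans_eq ?_
    simp only [norm_twistIntegrand]
  have h2 := sq_integral_le_of_quadratic (hb 2) (by simpa using hb 1) φ.integrable.norm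
    (fun t w => by
      have : ‖φ w‖ * (t * t) + -2 * (‖φ w‖ * ‖g (x + K w)‖) * t + ‖φ w‖ * ‖g (x + K w)‖ ^ 2 =
        ‖φ w‖ * (t - ‖g (x + K w)‖) ^ 2 := by ring
      rw [this]; positivity)
  rw [mul_comm]
  exact (pow_le_pow_left₀ (norm_nonneg _) h1 2).trans h2

/-- Modulated translations are isometries of L², so their superposition with weight φ costs at most
‖φ‖₁. The proof is Cauchy–Schwarz with respect to the weight ‖φ‖, then Fubini. -/
theorem norm_toLp_two_twist_le (K : E →L[ℝ] E) (φ g F : 𝓢(E, ℂ)) (hF : ∀ x, F x = twist K φ g x) :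
    ‖F.toLp 2 (volume : Measure E)‖ ≤
      ‖φ.toLp 1 (volume : Measure E)‖ * ‖g.toLp 2 (volume : Measure E)‖ := by
  rw [norm_toLp_one]
  refine le_of_sq_le_sq ?_ (by positivity)
  rw [mul_pow, norm_toLp_two_sq, norm_toLp_two_sq]
  have hs := integrable_shear K φ.integrable.norm (integrable_norm_sq g) φ.continuous.norm
    (g.continuous.norm.pow 2)
  calc ∫ x, ‖F x‖ ^ 2 ≤ ∫ x, (∫ w, ‖φ w‖) * ∫ w, ‖φ w‖ * ‖g (x + K w)‖ ^ 2 := by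
        refine integral_mono (integrable_norm_sq F) (hs.integral_prod_right.const_mul _) fun x => ?_
        simp only [hF]
        exact sq_norm_twist_le K φ g x
    _ = (∫ w, ‖φ w‖) * ∫ w, ∫ x, ‖φ w‖ * ‖g (x + K w)‖ ^ 2 := by
        rw [integral_const_mul, integral_integral_swap]
        exact hs.swap
    _ = _ := by
        have : ∀ w, ∫ x, ‖φ w‖ * ‖g (x + K w)‖ ^ 2 = ‖φ w‖ * ∫ x, ‖g x‖ ^ 2 := fun w => by
          rw [integral_const_mul, integral_add_right_eq_self fun y => ‖g y‖ ^ 2]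
        simp only [this]
        rw [integral_mul_const]; ring

/-- Here Cauchy–Schwarz is used in w itself, and the change of variables by K gives control of the
sup norm by L² norms alone. This is what allows an L² operator norm to control pointwise values. -/
theorem norm_twist_le_of_integral_comp {K : E →L[ℝ] E} {c : ℝ}
    (hc : ∀ h : E → ℝ, Integrable h → Integrable (fun w => h (K w)) ∧ ∫ w, h (K w) = c * ∫ w, h w)
    (φ g : 𝓢(E, ℂ)) (x : E) :
    ‖twist K φ g x‖ ^ 2 ≤
      (c * ‖φ.toLp 2 (volume : Measure E)‖ ^ 2) * ‖g.toLp 2 (volume : Measure E)‖ ^ 2 := by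
  obtain ⟨h1, h2⟩ := hc (fun y => ‖g (x + y)‖ ^ 2) ((integrable_norm_sq g).comp_add_left x)
  rw [integral_add_left_eq_self fun y => ‖g y‖ ^ 2] at h2
  have h3 : ‖twist K φ g x‖ ≤ ∫ w, ‖φ w‖ * ‖g (x + K w)‖ := by
    refine (norm_integral_le_integral_norm _).trans_eq ?_
    simp only [norm_twistIntegrand]
  have h4 : Integrable fun w => ‖φ w‖ * ‖g (x + K w)‖ := by
    simpa only [norm_twistIntegrand] using (integrable_twistIntegrand K φ g x).norm
  have h5 := sq_integral_le_of_quadratic h1 h4 (integrable_norm_sq φ)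
    (fun t w => by
      have : ‖φ w‖ ^ 2 * (t * t) + -2 * (‖φ w‖ * ‖g (x + K w)‖) * t + ‖g (x + K w)‖ ^ 2 =
        (‖φ w‖ * t - ‖g (x + K w)‖) ^ 2 := by ring
      rw [this]; positivity)
  rw [norm_toLp_two_sq, norm_toLp_two_sq]
  refine (pow_le_pow_left₀ (norm_nonneg _) h3 2).trans (h5.trans_eq ?_)
  rw [h2]; ring

/-- The integral is a trace: `∫ f ⋆ g = ∫ f g`. -/
theorem integral_weylMul {K : E →L[ℝ] E} (hK : IsSkew K) (f g : 𝓢(E, ℂ)) :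
    ∫ x, weylMul hK f g x = ∫ x, f x * g x := by
  have hs := (integrable_shear K (𝓕 g).integrable f.integrable (𝓕 g).continuous f.continuous)
  have hs' : Integrable (fun p : E × E => twistIntegrand K (𝓕 g) f p.2 p.1)
      (volume.prod volume) := by
    refine hs.mono (Continuous.aestronglyMeasurable ?_) (Eventually.of_forall fun p => ?_)
    · have h1 := (𝓕 g).continuous
      have h2 := f.continuous
      have h3 := continuous_fourierChar_coe
      unfold twistIntegrand
      fun_prop
    · rw [norm_twistIntegrand, norm_mul]
  simp only [weylMul_apply, twist]
  rw [integral_integral_swap hs'.swap]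
  -- Shifting x by Kw leaves the character unchanged because ⟨w, Kw⟩ = 0, so the inner integral is
  -- an inverse Fourier transform and Parseval finishes.
  have h1 : ∀ w, ∫ x, twistIntegrand K (𝓕 g) f x w = 𝓕 g w * (𝓕⁻ f) w := fun w => by
    rw [fourierInv_coe, Real.fourierInv_eq, ← integral_const_mul]
    refine Eq.trans ?_ (integral_add_right_eq_self
      (fun x => 𝓕 g w * (Real.fourierChar ⟪x, w⟫ • f x)) (K w))
    congr 1 with x
    rw [twistIntegrand, Circle.smul_def, smul_eq_mul, inner_add_left, real_inner_comm w (K w),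
      hK.inner_self, add_zero, real_inner_comm]
    ring
  simp only [h1]
  rw [integral_fourier_mul_eq g (𝓕⁻ f), FourierTransform.fourier_fourierInv_eq]
  simp only [mul_comm]

end LTwo

/-! ### Left multiplication operators -/

section LeftOp

open scoped RealInnerProductSpace

variable {E : Type*} [NormedAddCommGroup E] [InnerProductSpace ℝ E] [FiniteDimensional ℝ E]
  [MeasurableSpace E] [BorelSpace E] {K : E →L[ℝ] E}

/-- The inclusion of the Schwartz space into `L²`. -/
def toLTwo (E : Type*) [NormedAddCommGroup E] [InnerProductSpace ℝ E] [FiniteDimensional ℝ E]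
    [MeasurableSpace E] [BorelSpace E] : 𝓢(E, ℂ) →L[ℂ] Lp ℂ 2 (volume : Measure E) :=
  toLpCLM ℂ ℂ 2 volume

theorem toLTwo_apply (f : 𝓢(E, ℂ)) : toLTwo E f = f.toLp 2 volume := rfl

theorem denseRange_toLTwo : DenseRange (toLTwo E) :=
  denseRange_toLpCLM (F := ℂ) (E := E) (p := 2) (μ := volume) (by simp)

theorem norm_toLTwo_weylMul_le (hK : IsSkew K) (f g : 𝓢(E, ℂ)) :
    ‖toLTwo E (weylMul hK f g)‖ ≤ ‖(𝓕 f).toLp 1 (volume : Measure E)‖ * ‖toLTwo E g‖ :=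
  norm_toLp_two_twist_le (-K) (𝓕 f) g _ (weylMul_apply' hK f g)

/-- The bounded operator on `L²` extending the twisted product with `f` from the left. -/
def leftOp (hK : IsSkew K) (f : 𝓢(E, ℂ)) :
    Lp ℂ 2 (volume : Measure E) →L[ℂ] Lp ℂ 2 (volume : Measure E) :=
  ((toLTwo E).toLinearMap ∘ₗ weylMul hK f).extendOfNorm (toLTwo E).toLinearMap

theorem leftOp_toLTwo (hK : IsSkew K) (f g : 𝓢(E, ℂ)) :
    leftOp hK f (toLTwo E g) = toLTwo E (weylMul hK f g) :=
  LinearMap.extendOfNorm_eq (f := (toLTwo E).toLinearMap ∘ₗ weylMul hK f)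
    (e := (toLTwo E).toLinearMap) denseRange_toLTwo ⟨_, norm_toLTwo_weylMul_le hK f⟩ g

theorem norm_leftOp_le (hK : IsSkew K) (f : 𝓢(E, ℂ)) :
    ‖leftOp hK f‖ ≤ ‖(𝓕 f).toLp 1 (volume : Measure E)‖ :=
  ContinuousLinearMap.opNorm_le_bound _ (norm_nonneg _)
    (LinearMap.norm_extendOfNorm_apply_le (f := (toLTwo E).toLinearMap ∘ₗ weylMul hK f)
      (e := (toLTwo E).toLinearMap) denseRange_toLTwo _ (norm_toLTwo_weylMul_le hK f))

theorem eq_of_toLTwo {S T : Lp ℂ 2 (volume : Measure E) →L[ℂ] Lp ℂ 2 (volume : Measure E)}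
    (h : ∀ g, S (toLTwo E g) = T (toLTwo E g)) : S = T :=
  DFunLike.coe_injective (denseRange_toLTwo.equalizer S.continuous T.continuous (funext h))

/-- Left multiplication operators as a linear map. -/
def leftOpₗ (hK : IsSkew K) :
    𝓢(E, ℂ) →ₗ[ℂ] (Lp ℂ 2 (volume : Measure E) →L[ℂ] Lp ℂ 2 (volume : Measure E)) where
  toFun := leftOp hK
  map_add' f g := eq_of_toLTwo fun h => by
    rw [_root_.add_apply, leftOp_toLTwo, leftOp_toLTwo, leftOp_toLTwo, map_add,
      LinearMap.add_apply, map_add]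
  map_smul' c f := eq_of_toLTwo fun h => by
    rw [_root_.smul_apply, leftOp_toLTwo, leftOp_toLTwo, map_smul, LinearMap.smul_apply, map_smul,
      RingHom.id_apply]

theorem leftOpₗ_apply (hK : IsSkew K) (f : 𝓢(E, ℂ)) : leftOpₗ hK f = leftOp hK f := rfl

theorem leftOp_weylMul (hK : IsSkew K) (f g : 𝓢(E, ℂ)) :
    leftOp hK (weylMul hK f g) = leftOp hK f * leftOp hK g :=
  eq_of_toLTwo fun h => by
    rw [_root_.mul_apply_eq_comp, leftOp_toLTwo, leftOp_toLTwo, leftOp_toLTwo, weylMul_assoc]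

theorem continuous_leftOp (hK : IsSkew K) : Continuous (leftOp hK) := by
  change Continuous (leftOpₗ hK)
  refine continuous_of_continuousAt_zero (leftOpₗ hK) ?_
  have h0 : Tendsto (fun f : 𝓢(E, ℂ) => ‖(𝓕 f).toLp 1 (volume : Measure E)‖) (𝓝 0) (𝓝 0) := by
    have := (continuous_norm_fourier_toLp_one (E := E)).tendsto 0
    rwa [FourierTransform.fourier_zero, ← toLpCLM_apply (𝕜 := ℂ), map_zero, norm_zero] at this
  rw [ContinuousAt, map_zero]
  exact squeeze_zero_norm (norm_leftOp_le hK) h0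

theorem injective_toLTwo : Function.Injective (toLTwo E) :=
  injective_toLp 2 (volume : Measure E)

/-- If L_f = 0 then f ⋆ f̄ = 0, and the trace identity gives ∫ |f|² = 0. -/
theorem leftOp_injective (hK : IsSkew K) {f f' : 𝓢(E, ℂ)} (hf : ∀ x, f' x = conj (f x))
    (h : leftOp hK f = 0) : f = 0 := by
  have h1 : weylMul hK f f' = 0 := injective_toLTwo <| by
    rw [← leftOp_toLTwo, h, map_zero, _root_.zero_apply]
  have h2 := integral_weylMul hK f f'
  have h3 : ∀ x, f x * f' x = ((‖f x‖ ^ 2 : ℝ) : ℂ) := fun x => by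
    rw [hf, Complex.mul_conj, Complex.normSq_eq_norm_sq]
  simp only [h1, _root_.zero_apply, integral_zero, h3] at h2
  rw [integral_complex_ofReal, ← norm_toLp_two_sq, eq_comm, Complex.ofReal_eq_zero,
    sq_eq_zero_iff, norm_eq_zero] at h2
  exact injective_toLTwo (by rw [map_zero]; exact h2)

/-- By the trace identity both inner products are integrals of one triple product, bracketed in two
ways. -/
theorem inner_leftOp (hK : IsSkew K) {f f' : 𝓢(E, ℂ)} (hf : ∀ x, f' x = conj (f x))
    (conjS : 𝓢(E, ℂ) → 𝓢(E, ℂ)) (hconj : ∀ g x, conjS g x = conj (g x))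
    (g h : 𝓢(E, ℂ)) :
    inner ℂ (leftOp hK f' (toLTwo E g)) (toLTwo E h) =
      inner ℂ (toLTwo E g) (leftOp hK f (toLTwo E h)) := by
  rw [leftOp_toLTwo, leftOp_toLTwo]
  simp only [toLTwo_apply, inner_toL2_toL2_eq, RCLike.inner_apply, ← hconj]
  have h1 : conjS (weylMul hK f' g) = weylMul hK (conjS g) f := by
    ext x
    rw [hconj, conj_weylMul hK f' g f (conjS g) (fun x => by rw [hf, Complex.conj_conj]) (hconj g)]
  have h2 : ∀ a b : 𝓢(E, ℂ), ∫ x, a x * b x = ∫ x, weylMul hK b a x := fun a b => by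
    rw [integral_weylMul]; simp only [mul_comm]
  rw [h2, h2, h1, weylMul_assoc]

theorem star_leftOp (hK : IsSkew K) {f f' : 𝓢(E, ℂ)} (hf : ∀ x, f' x = conj (f x))
    (conjS : 𝓢(E, ℂ) → 𝓢(E, ℂ)) (hconj : ∀ g x, conjS g x = conj (g x)) :
    leftOp hK f' = star (leftOp hK f) := by
  rw [ContinuousLinearMap.star_eq_adjoint, ContinuousLinearMap.eq_adjoint_iff]
  intro x y
  refine denseRange_toLTwo.induction_on₂ (p := fun x y =>
    inner ℂ (leftOp hK f' x) y = inner ℂ x (leftOp hK f y)) ?_ (inner_leftOp hK hf conjS hconj) x y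
  exact isClosed_eq (by fun_prop) (by fun_prop)

/-- The trace identity gives ∫ G = ∫ G ⋆ e = ∫ G e for all test functions G, hence e = 1 almost
everywhere. This contradicts integrability, as a nonzero space has infinite volume. -/
theorem not_exists_unit [Nontrivial E] (hK : IsSkew K) :
    ¬ ∃ e : 𝓢(E, ℂ), ∀ f, weylMul hK f e = f := by
  rintro ⟨e, he⟩
  have hloc : LocallyIntegrable (fun x => 1 - e x : E → ℂ) volume :=
    (continuous_const.sub e.continuous).locallyIntegrable
  have h0 := ae_eq_zero_of_integral_contDiff_smul_eq_zero hloc fun g hg hgc => by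
    let G : 𝓢(E, ℂ) := HasCompactSupport.toSchwartzMap (f := fun x => (g x : ℂ))
      (hgc.comp_left (g := fun r : ℝ => (r : ℂ)) Complex.ofReal_zero)
      (Complex.ofRealCLM.contDiff.comp hg)
    have hG : ∀ x, G x = g x := fun x => rfl
    have h1 := integral_weylMul hK G e
    rw [he] at h1
    have h2 : ∀ x, g x • (1 - e x) = G x - G x * e x := fun x => by
      rw [hG, Complex.real_smul]; ring
    simp only [h2]
    rw [integral_sub G.integrable, h1, sub_self]
    exact e.integrable.bdd_mul G.continuous.aestronglyMeasurable
      (Eventually.of_forall fun x => norm_le_seminorm ℝ G x)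
  have h1 : Integrable (fun _ : E => (1 : ℂ)) :=
    e.integrable.congr (h0.mono fun x hx => (sub_eq_zero.1 hx).symm)
  rw [integrable_const_iff] at h1
  rcases h1 with h | h
  · exact one_ne_zero h
  · exact (measure_ne_top (volume : Measure E) Set.univ) (by simp)

/-! ### Two-sided products with bounded operators -/

/-- Twisted multiplication by the linear function `⟨·, v⟩` from the left. -/
def weylX (K : E →L[ℝ] E) (v : E) : 𝓢(E, ℂ) →L[ℂ] 𝓢(E, ℂ) :=
  mulInner v - (2 * Real.pi * Complex.I : ℂ)⁻¹ • dirDeriv (K v)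

theorem weylX_apply (K : E →L[ℝ] E) (v : E) (f : 𝓢(E, ℂ)) (x : E) :
    weylX K v f x = (⟪v, x⟫ : ℂ) * f x - (2 * Real.pi * Complex.I : ℂ)⁻¹ * dirDeriv (K v) f x := by
  rw [weylX, _root_.sub_apply, _root_.sub_apply, mulInner_apply, real_inner_comm]
  rfl

/-- Both the coordinate rule and the Leibniz rule produce a term in which g is differentiated along
Kv; the coefficient in `weylX` is chosen so that these cancel. -/
theorem weylX_weylMul_left (hK : IsSkew K) (v : E) (f g : 𝓢(E, ℂ)) :
    weylX K v (weylMul hK f g) = weylMul hK (weylX K v f) g := by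
  ext x
  have h1 : (⟪v, x⟫ : ℂ) * weylMul hK f g x = weylMul hK (mulInner v f) g x +
      weylMul hK f ((2 * Real.pi * Complex.I : ℂ)⁻¹ • dirDeriv (K v) g) x :=
    inner_mul_twist_fourier hK f g x v
  have h2 : dirDeriv (K v) (weylMul hK f g) x = weylMul hK (dirDeriv (K v) f) g x +
      weylMul hK f (dirDeriv (K v) g) x := fderiv_twist_fourier K f g x (K v)
  have h3 : weylX K v f = mulInner v f - (2 * Real.pi * Complex.I : ℂ)⁻¹ • dirDeriv (K v) f := rfl
  rw [weylX_apply, h1, h2, h3, map_sub, map_smul, map_smul, LinearMap.sub_apply,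
    LinearMap.smul_apply, _root_.sub_apply, _root_.smul_apply, _root_.smul_apply, smul_eq_mul,
    smul_eq_mul]
  ring

theorem weylX_weylMul_right (hK : IsSkew K) (v : E) (f g : 𝓢(E, ℂ)) :
    weylX (-K) v (weylMul hK f g) = weylMul hK f (weylX (-K) v g) := by
  rw [weylMul_comm hK, weylX_weylMul_left, weylMul_comm hK]

theorem inner_mul_eq_weylX (K : E →L[ℝ] E) (v : E) (f : 𝓢(E, ℂ)) (x : E) :
    (⟪v, x⟫ : ℂ) * f x = 2⁻¹ * weylX K v f x + 2⁻¹ * weylX (-K) v f x := by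
  have : dirDeriv ((-K) v) f x = -dirDeriv (K v) f x := by
    rw [dirDeriv_apply, dirDeriv_apply, _root_.neg_apply, map_neg]
  rw [weylX_apply, weylX_apply, this]
  ring

/-- Left and right multiplication by a linear function differ by a derivative along Kv, while their
mean is the ordinary multiplication. -/
theorem dirDeriv_eq_weylX (K : E →L[ℝ] E) (v : E) (f : 𝓢(E, ℂ)) (x : E) :
    dirDeriv (K v) f x = -(Real.pi * Complex.I) * weylX K v f x +
      (Real.pi * Complex.I) * weylX (-K) v f x := by
  have : dirDeriv ((-K) v) f x = -dirDeriv (K v) f x := by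
    rw [dirDeriv_apply, dirDeriv_apply, _root_.neg_apply, map_neg]
  have h2 : (Real.pi * Complex.I : ℂ) * (2 * Real.pi * Complex.I)⁻¹ = 2⁻¹ := by
    have := two_pi_I_ne_zero
    field_simp
  rw [weylX_apply, weylX_apply, this]
  linear_combination (-2 * dirDeriv (K v) f x) * h2

/-- The pair of operators acting on the outer factors of a twisted product as a multiple of
a left, respectively right, multiplication by a linear function. -/
def weylPair (K : E →L[ℝ] E) (c d : ℂ) (v : E) (s : Bool) :
    (𝓢(E, ℂ) →L[ℂ] 𝓢(E, ℂ)) × (𝓢(E, ℂ) →L[ℂ] 𝓢(E, ℂ)) :=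
  if s then (c • weylX K v, .id ℂ _) else (.id ℂ _, d • weylX (-K) v)

/-- All operators fall on the outer factors and t is never touched. The vectors `u i` express each
basis derivative as one along the range of K. -/
theorem isWeylStable_weylMul_weylMul {ι : Type} [Fintype ι] (b : OrthonormalBasis ι ℝ E)
    (hK : IsSkew K) (u : ι → E) (hu : ∀ i, K (u i) = b i) (t : 𝓢(E, ℂ)) :
    IsWeylStable b (fun f g : 𝓢(E, ℂ) => ⇑(weylMul hK f (weylMul hK t g)))
      (fun i => weylPair K (-(Real.pi * Complex.I)) (Real.pi * Complex.I) (u i))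
      (fun i => weylPair K 2⁻¹ 2⁻¹ (b i)) where
  differentiable f g := (weylMul hK f (weylMul hK t g)).differentiable
  fderiv_apply f g x i := by
    rw [← dirDeriv_apply, ← hu, dirDeriv_eq_weylX, weylX_weylMul_left, weylX_weylMul_right,
      weylX_weylMul_right]
    simp [weylPair]
  inner_mul f g x i := by
    rw [inner_mul_eq_weylX K, weylX_weylMul_left, weylX_weylMul_right, weylX_weylMul_right]
    simp [weylPair]

/-- Composition with the linear map `K` multiplies integrals by `c`. -/
def ScalesIntegral (K : E →L[ℝ] E) (c : ℝ) : Prop :=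
  ∀ h : E → ℝ, Integrable h → Integrable (fun w => h (K w)) ∧ ∫ w, h (K w) = c * ∫ w, h w

/-- The supremum norm of `f ⋆ (t ⋆ g)` is bounded by the operator norm of `t`. -/
def sandwichBound (c : ℝ) (M : ℝ) (f g : 𝓢(E, ℂ)) : ℝ :=
  √c * ‖(𝓕 f).toLp 2 (volume : Measure E)‖ * ‖toLTwo E g‖ * M

theorem norm_weylMul_weylMul_le (hK : IsSkew K) {c : ℝ} (hc0 : 0 ≤ c) (hc : ScalesIntegral (-K) c)
    (f t g : 𝓢(E, ℂ)) (x : E) :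
    ‖weylMul hK f (weylMul hK t g) x‖ ≤ sandwichBound c ‖leftOp hK t‖ f g := by
  have h1 := norm_twist_le_of_integral_comp hc (𝓕 f) (weylMul hK t g) x
  rw [← weylMul_apply' hK] at h1
  have h2 : ‖toLTwo E (weylMul hK t g)‖ ≤ ‖leftOp hK t‖ * ‖toLTwo E g‖ := by
    rw [← leftOp_toLTwo]; exact ContinuousLinearMap.le_opNorm _ _
  refine le_of_sq_le_sq ?_ (by unfold sandwichBound; positivity)
  refine h1.trans ?_
  have h3 : ‖(weylMul hK t g).toLp 2 (volume : Measure E)‖ ^ 2 ≤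
      (‖leftOp hK t‖ * ‖toLTwo E g‖) ^ 2 := pow_le_pow_left₀ (norm_nonneg _) h2 2
  refine (mul_le_mul_of_nonneg_left h3 (by positivity)).trans_eq ?_
  unfold sandwichBound
  rw [mul_pow, mul_pow, mul_pow, mul_pow, Real.sq_sqrt hc0]
  ring

theorem exists_seminorm_sandwich_le (hK : IsSkew K) (hsurj : Function.Surjective K) {c : ℝ}
    (hc0 : 0 ≤ c) (hc : ScalesIntegral (-K) c) (f g : 𝓢(E, ℂ)) (k n : ℕ) :
    ∃ C : ℝ, ∀ t, SchwartzMap.seminorm ℝ k n (weylMul hK f (weylMul hK t g)) ≤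
      C * ‖leftOp hK t‖ := by
  let b := stdOrthonormalBasis ℝ E
  choose u hu using fun i => hsurj (b i)
  obtain ⟨κ, _, A, hA⟩ := exists_weyl_bound b
    (fun i => weylPair K (-(Real.pi * Complex.I)) (Real.pi * Complex.I) (u i))
    (fun i => weylPair K 2⁻¹ 2⁻¹ (b i)) k n
  -- `sandwichBound` is linear in its norm argument, so the value 1 isolates the constant.
  refine ⟨∑ j, sandwichBound c 1 ((A j).1 f) ((A j).2 g), fun t => ?_⟩
  have := hA _ (isWeylStable_weylMul_weylMul b hK u hu t) (sandwichBound c ‖leftOp hK t‖)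
    (fun f g x => norm_weylMul_weylMul_le hK hc0 hc f t g x) f g
  have h2 : ∑ j, sandwichBound c ‖leftOp hK t‖ ((A j).1 f) ((A j).2 g) =
      (∑ j, sandwichBound c 1 ((A j).1 f) ((A j).2 g)) * ‖leftOp hK t‖ := by
    rw [Finset.sum_mul]
    exact Finset.sum_congr rfl fun j _ => by unfold sandwichBound; ring
  rw [← h2]
  exact SchwartzMap.seminorm_le_bound ℝ k n _ (le_trans (by positivity) (this 0)) this

/-- If L_{t_n} → T in norm, the seminorm estimate makes f ⋆ t_n ⋆ g Cauchy in 𝒮. Its limit k exists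
by completeness, and continuity of f ↦ L_f identifies L_k. -/
theorem exists_leftOp_eq_sandwich (hK : IsSkew K) (hsurj : Function.Surjective K) {c : ℝ}
    (hc0 : 0 ≤ c) (hc : ScalesIntegral (-K) c) (f g : 𝓢(E, ℂ))
    {T : Lp ℂ 2 (volume : Measure E) →L[ℂ] Lp ℂ 2 (volume : Measure E)}
    (hT : T ∈ closure (Set.range (leftOp hK))) :
    ∃ k, leftOp hK k = leftOp hK f * T * leftOp hK g := by
  obtain ⟨s, hs, hsT⟩ := mem_closure_iff_seq_limit.1 hT
  choose t ht using hs
  obtain rfl : (fun n => leftOp hK (t n)) = s := funext ht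
  have hcau : CauchySeq fun n => weylMul hK f (weylMul hK (t n) g) := by
    rw [cauchySeq_iff_tendsto, uniformity_eq_comap_nhds_zero, tendsto_comap_iff]
    refine ((schwartz_withSeminorms ℝ E ℂ).tendsto_nhds _ _).2 ?_
    rintro ⟨k, n⟩ ε hε
    obtain ⟨C, hC⟩ := exists_seminorm_sandwich_le hK hsurj hc0 hc f g k n
    have h1 : Tendsto (fun p : ℕ × ℕ => C * ‖leftOp hK (t p.2) - leftOp hK (t p.1)‖) atTop (𝓝 0) := by
      have := hsT.cauchySeq.tendsto_uniformity
      rw [uniformity_eq_comap_nhds_zero, tendsto_comap_iff] at this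
      simpa using (this.norm.const_mul C)
    filter_upwards [h1.eventually (gt_mem_nhds hε)] with p hp
    refine lt_of_le_of_lt ?_ hp
    rw [← leftOpₗ_apply, ← leftOpₗ_apply, ← map_sub]
    refine le_trans (le_of_eq ?_) (hC _)
    simp only [Function.comp, Prod.map, sub_zero, map_sub, LinearMap.sub_apply]
    rfl
  obtain ⟨k, hk⟩ := cauchySeq_tendsto_of_complete hcau
  refine ⟨k, tendsto_nhds_unique (((continuous_leftOp hK).tendsto k).comp hk) ?_⟩
  have : (leftOp hK ∘ fun n => weylMul hK f (weylMul hK (t n) g)) =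
      fun n => leftOp hK f * leftOp hK (t n) * leftOp hK g := by
    ext1 n
    rw [Function.comp, leftOp_weylMul, leftOp_weylMul, mul_assoc]
  rw [this]
  exact (hsT.const_mul _).mul_const _

end LeftOp

/-! ### The Moyal product -/

section Moyal

open scoped RealInnerProductSpace

/-- The symplectic matrix as a linear map on phase space. -/
def symplecticJ (N : ℕ) : PhaseSpace N →L[ℝ] PhaseSpace N :=
  Matrix.toEuclideanCLM (𝕜 := ℝ) (symplecticS N)

theorem ofLp_symplecticJ {N : ℕ} (x : PhaseSpace N) :
    (symplecticJ N x).ofLp = symplecticS N *ᵥ x.ofLp := rfl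

theorem inner_eq_dotProduct {N : ℕ} (x y : PhaseSpace N) : ⟪x, y⟫ = x.ofLp ⬝ᵥ y.ofLp := by
  rw [EuclideanSpace.inner_eq_star_dotProduct, dotProduct_comm]; simp

theorem isSkew_symplecticJ (N : ℕ) : IsSkew (symplecticJ N) := fun v w => by
  have h : (symplecticS N)ᵀ = -symplecticS N := by
    simp [symplecticS, Matrix.fromBlocks_transpose, Matrix.fromBlocks_neg]
  rw [inner_eq_dotProduct, inner_eq_dotProduct, ofLp_symplecticJ, ofLp_symplecticJ,
    dotProduct_comm, Matrix.dotProduct_mulVec, ← Matrix.mulVec_transpose, h, Matrix.neg_mulVec,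
    neg_dotProduct, dotProduct_comm]

theorem symplecticJ_symplecticJ {N : ℕ} (x : PhaseSpace N) :
    symplecticJ N (symplecticJ N x) = -x := by
  have h : symplecticS N * symplecticS N = -1 := by
    rw [symplecticS, Matrix.fromBlocks_multiply, ← Matrix.fromBlocks_one, Matrix.fromBlocks_neg]
    simp
  refine (WithLp.ofLp_injective 2) ?_
  rw [ofLp_symplecticJ, ofLp_symplecticJ, Matrix.mulVec_mulVec, h, Matrix.neg_mulVec,
    Matrix.one_mulVec]
  rfl

theorem inner_symplecticJ_symplecticJ {N : ℕ} (x y : PhaseSpace N) :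
    ⟪symplecticJ N x, symplecticJ N y⟫ = ⟪x, y⟫ := by
  rw [isSkew_symplecticJ, symplecticJ_symplecticJ, inner_neg_right, neg_neg]

/-- The symplectic matrix as a linear isometry of phase space. -/
def symplecticIsometry (N : ℕ) : PhaseSpace N ≃ₗᵢ[ℝ] PhaseSpace N where
  toLinearEquiv := LinearEquiv.ofLinearMap (symplecticJ N).toLinearMap (-symplecticJ N).toLinearMap
    (by ext1 x; simp [symplecticJ_symplecticJ]) (by ext1 x; simp [symplecticJ_symplecticJ])
  norm_map' x := by
    change ‖symplecticJ N x‖ = ‖x‖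
    rw [@norm_eq_sqrt_real_inner _ _ _ (symplecticJ N x), inner_symplecticJ_symplecticJ,
      ← norm_eq_sqrt_real_inner]

theorem finrank_phaseSpace (N : ℕ) : Module.finrank ℝ (PhaseSpace N) = 2 * N := by
  rw [finrank_euclideanSpace, Fintype.card_sum, Fintype.card_fin, two_mul]

theorem integral_comp_smul_symplecticJ {N : ℕ} {G : Type*} [NormedAddCommGroup G] [NormedSpace ℝ G]
    (r : ℝ) (h : PhaseSpace N → G) :
    ∫ w, h (r • symplecticJ N w) = (r ^ (2 * N))⁻¹ • ∫ w, h w := by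
  have h1 := (symplecticIsometry N).measurePreserving.integral_comp
    (symplecticIsometry N).toHomeomorph.measurableEmbedding fun w => h (r • w)
  refine h1.trans ?_
  -- The dimension 2N is even, so no absolute value remains in the Jacobian.
  rw [Measure.integral_comp_smul, finrank_phaseSpace, abs_inv, abs_of_nonneg]
  exact (even_two_mul N).pow_nonneg r

theorem integrable_comp_smul_symplecticJ {N : ℕ} {r : ℝ} (hr : r ≠ 0) {h : PhaseSpace N → ℝ}
    (hh : Integrable h) : Integrable fun w => h (r • symplecticJ N w) :=
  (symplecticIsometry N).measurePreserving.integrable_comp_of_integrable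
    ((integrable_comp_smul_iff volume h hr).2 hh)

/-- The linear map by which the Moyal product is twisted. -/
def moyalK (N : ℕ) (θ : ℝ) : PhaseSpace N →L[ℝ] PhaseSpace N := -((Real.pi * θ) • symplecticJ N)

theorem moyalK_apply {N : ℕ} {θ : ℝ} (w : PhaseSpace N) :
    moyalK N θ w = (-(Real.pi * θ)) • symplecticJ N w := by
  rw [moyalK, _root_.neg_apply, _root_.smul_apply, neg_smul]

theorem isSkew_moyalK (N : ℕ) (θ : ℝ) : IsSkew (moyalK N θ) := fun v w => by
  rw [moyalK_apply, moyalK_apply, real_inner_smul_left, real_inner_smul_right, isSkew_symplecticJ]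
  ring

theorem surjective_moyalK {N : ℕ} {θ : ℝ} (hθ : θ ≠ 0) : Function.Surjective (moyalK N θ) := by
  intro y
  have h : Real.pi * θ ≠ 0 := mul_ne_zero Real.pi_ne_zero hθ
  refine ⟨(Real.pi * θ)⁻¹ • symplecticJ N y, ?_⟩
  rw [moyalK_apply, map_smul, symplecticJ_symplecticJ, neg_smul, smul_inv_smul₀ h, neg_neg]

theorem scalesIntegral_neg_moyalK {N : ℕ} {θ : ℝ} (hθ : θ ≠ 0) :
    ScalesIntegral (-moyalK N θ) ((Real.pi * θ) ^ (2 * N))⁻¹ := fun h hh => by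
  have e : ∀ w, (-moyalK N θ) w = (Real.pi * θ) • symplecticJ N w := fun w => by
    rw [moyalK, neg_neg, _root_.smul_apply]
  simp only [e]
  exact ⟨integrable_comp_smul_symplecticJ (mul_ne_zero Real.pi_ne_zero hθ) hh,
    integral_comp_smul_symplecticJ _ h⟩

/-- This explains the choice of K: for y = x + Kw one has x - y = πθ Sw, and orthogonality of S
reduces the exponent to 2πi⟨w, x - z⟩. -/
theorem moyal_phase {N : ℕ} {θ : ℝ} (hθ : θ ≠ 0) (x w z : PhaseSpace N) :
    Complex.exp (2 * Complex.I / θ * (((x - (x + moyalK N θ w)).ofLp ⬝ᵥ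
      (symplecticS N *ᵥ (x - z).ofLp) : ℝ) : ℂ)) =
      Real.fourierChar ⟪w, x⟫ * Real.fourierChar (-⟪z, w⟫) := by
  have h1 : (x - (x + moyalK N θ w)).ofLp ⬝ᵥ (symplecticS N *ᵥ (x - z).ofLp) =
      Real.pi * θ * (⟪w, x⟫ - ⟪z, w⟫) := by
    rw [← ofLp_symplecticJ, ← inner_eq_dotProduct, sub_add_cancel_left, moyalK_apply, neg_smul,
      neg_neg, real_inner_smul_left, inner_symplecticJ_symplecticJ, inner_sub_right,
      real_inner_comm z w]
  have hθ' : (θ : ℂ) ≠ 0 := Complex.ofReal_ne_zero.2 hθ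
  rw [h1, ← Circle.coe_mul, ← AddChar.map_add_eq_mul, Real.fourierChar_apply]
  congr 1
  push_cast
  field_simp
  ring

/-- The Jacobian of y = x + Kw is exactly the prefactor of the Moyal product, and the remaining
z-integral is ĝ(w). -/
theorem moyalProduct_eq_twist {N : ℕ} {θ : ℝ} (hθ : θ ≠ 0) (f g : 𝓢(PhaseSpace N, ℂ))
    (x : PhaseSpace N) : moyalProduct θ f g x = twist (moyalK N θ) (𝓕 g) f x := by
  rw [moyalProduct]
  set F : PhaseSpace N → ℂ := fun y => ∫ z, f y * g z * Complex.exp (2 * Complex.I / θ *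
    (((x - y).ofLp ⬝ᵥ (symplecticS N *ᵥ (x - z).ofLp) : ℝ) : ℂ)) with hF
  have h1 : ∫ w, F (x + moyalK N θ w) = (((Real.pi * θ) ^ (2 * N))⁻¹ : ℝ) * ∫ y, F y := by
    simp only [moyalK_apply]
    rw [integral_comp_smul_symplecticJ (-(Real.pi * θ)) fun y => F (x + y),
      integral_add_left_eq_self F, (even_two_mul N).neg_pow, Complex.real_smul]
  rw [← h1, twist]
  congr 1 with w
  simp only [hF, moyal_phase hθ]
  rw [twistIntegrand, fourier_coe, Real.fourier_eq, mul_right_comm, mul_comm _ (f _),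
    ← integral_const_mul]
  congr 1 with z
  rw [Circle.smul_def, smul_eq_mul]
  ring

/-! ### The algebra generated by the left multiplications -/

theorem leftOp_isLeftMoyal {N : ℕ} {θ : ℝ} (hθ : θ ≠ 0) (f : 𝓢(PhaseSpace N, ℂ)) :
    IsLeftMoyal θ f (leftOp (isSkew_moyalK N θ) f) := fun g => by
  have h : (moyalProduct θ f g) = weylMul (isSkew_moyalK N θ) f g :=
    funext fun x => moyalProduct_eq_twist hθ f g x
  rw [← toLTwo_apply, leftOp_toLTwo, h]
  exact coeFn_toLp _ 2 volume

theorem IsLeftMoyal.eq_leftOp {N : ℕ} {θ : ℝ} (hθ : θ ≠ 0) {f : 𝓢(PhaseSpace N, ℂ)}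
    {T : L2 N →L[ℂ] L2 N} (hT : IsLeftMoyal θ f T) : T = leftOp (isSkew_moyalK N θ) f :=
  eq_of_toLTwo fun g => Lp.ext ((hT g).trans (leftOp_isLeftMoyal hθ f g).symm)

/-- The algebra of left multiplications by Schwartz functions. -/
def leftOpAlgebra (N : ℕ) (θ : ℝ) : NonUnitalStarSubalgebra ℂ (L2 N →L[ℂ] L2 N) where
  toNonUnitalSubalgebra :=
    { LinearMap.range (leftOpₗ (isSkew_moyalK N θ)) with
      mul_mem' := by
        rintro _ _ ⟨f, rfl⟩ ⟨g, rfl⟩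
        exact ⟨weylMul _ f g, leftOp_weylMul _ f g⟩ }
  star_mem' := by
    rintro _ ⟨f, rfl⟩
    exact ⟨schwartzConj N f, star_leftOp _ (schwartzConj_apply f) (schwartzConj N)
      schwartzConj_apply⟩

theorem coe_moyalCStar {N : ℕ} {θ : ℝ} (hθ : θ ≠ 0) :
    (moyalCStar N θ : Set (L2 N →L[ℂ] L2 N)) =
      closure (Set.range (leftOp (isSkew_moyalK N θ))) := by
  have h : NonUnitalStarAlgebra.adjoin ℂ
      {T : L2 N →L[ℂ] L2 N | ∃ f : 𝓢(PhaseSpace N, ℂ), IsLeftMoyal θ f T} = leftOpAlgebra N θ := by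
    apply le_antisymm
    · refine NonUnitalStarAlgebra.adjoin_le ?_
      rintro T ⟨f, hf⟩
      exact ⟨f, (hf.eq_leftOp hθ).symm⟩
    · rintro T ⟨f, rfl⟩
      exact NonUnitalStarAlgebra.subset_adjoin ℂ _ ⟨f, leftOp_isLeftMoyal hθ f⟩
  rw [moyalCStar, h]
  rfl

/-- Left Moyal multiplication as a linear map into the generated C⋆-algebra. -/
def moyalL (N : ℕ) {θ : ℝ} (hθ : θ ≠ 0) : 𝓢(PhaseSpace N, ℂ) →ₗ[ℂ] moyalCStar N θ where
  toFun f := ⟨leftOp (isSkew_moyalK N θ) f,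
    (coe_moyalCStar hθ).ge (subset_closure (Set.mem_range_self f))⟩
  map_add' f g := Subtype.ext ((leftOpₗ _).map_add f g)
  map_smul' c f := Subtype.ext ((leftOpₗ _).map_smul c f)

theorem moyalL_mul {N : ℕ} {θ : ℝ} (hθ : θ ≠ 0) (f g : 𝓢(PhaseSpace N, ℂ)) :
    moyalL N hθ (weylMul (isSkew_moyalK N θ) f g) = moyalL N hθ f * moyalL N hθ g :=
  Subtype.ext (leftOp_weylMul _ f g)

theorem moyalL_mul_mul_mem_range {N : ℕ} {θ : ℝ} (hθ : θ ≠ 0) (f g : 𝓢(PhaseSpace N, ℂ))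
    (T : moyalCStar N θ) : moyalL N hθ f * T * moyalL N hθ g ∈ Set.range (moyalL N hθ) := by
  obtain ⟨k, hk⟩ := exists_leftOp_eq_sandwich (isSkew_moyalK N θ) (surjective_moyalK hθ)
    (inv_nonneg.2 ((even_two_mul N).pow_nonneg _)) (scalesIntegral_neg_moyalK hθ) f g
    (T := T) ((coe_moyalCStar hθ).le T.2)
  exact ⟨k, Subtype.ext hk⟩

theorem denseRange_moyalL {N : ℕ} {θ : ℝ} (hθ : θ ≠ 0) : DenseRange (moyalL N hθ) := by
  intro T
  rw [closure_subtype, ← Set.range_comp]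
  exact (coe_moyalCStar hθ).le T.2

theorem continuous_schwartzConj (N : ℕ) : Continuous (schwartzConj N) :=
  (SchwartzMap.postcompCLM (𝕜 := ℝ) (E := PhaseSpace N) (Complex.conjCLE : ℂ →L[ℝ] ℂ)).continuous

theorem isFrechetStarAlgebra_weylMul (N : ℕ) (θ : ℝ) :
    IsFrechetStarAlgebra (weylMul (isSkew_moyalK N θ)) (schwartzConj N) where
  frechet := schwartz_isFrechetSpace
  mul_assoc := weylMul_assoc _
  inv_inv f := by ext x; rw [schwartzConj_apply, schwartzConj_apply, Complex.conj_conj]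
  inv_mul f g := by
    ext x
    rw [schwartzConj_apply]
    exact conj_weylMul _ f g _ _ (schwartzConj_apply f) (schwartzConj_apply g) x
  continuous_mul := continuous_weylMul _
  continuous_inv := continuous_schwartzConj N

theorem isFrechetPreCStarAlgebra_moyalL (N : ℕ) {θ : ℝ} (hθ : θ ≠ 0) :
    IsFrechetPreCStarAlgebra (weylMul (isSkew_moyalK N θ)) (schwartzConj N) (moyalL N hθ) where
  toIsFrechetStarAlgebra := isFrechetStarAlgebra_weylMul N θ
  map_mul := moyalL_mul hθ
  map_inv f := Subtype.ext (star_leftOp _ (schwartzConj_apply f) (schwartzConj N)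
    schwartzConj_apply)
  injective := (injective_iff_map_eq_zero _).2 fun f hf =>
    leftOp_injective _ (schwartzConj_apply f) (congrArg Subtype.val hf)
  continuous := (continuous_leftOp _).subtype_mk _
  denseRange := denseRange_moyalL hθ
  stable b hb U h _ _ hh Γ hΓ := snd_holomorphicCalculus_mem_range (moyalL N hθ)
    (fun f g => ⟨_, moyalL_mul hθ f g⟩) (fun f T g => moyalL_mul_mul_mem_range hθ f g T)
    b hb U h hh Γ hΓ.mem

end Moyal
end

theorem mainTheorem7 (N : ℕ) (hN : 0 < N) (θ : ℝ) (hθ : θ ≠ 0) :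
    ∃ (mul : 𝓢(PhaseSpace N, ℂ) →ₗ[ℂ] 𝓢(PhaseSpace N, ℂ) →ₗ[ℂ] 𝓢(PhaseSpace N, ℂ))
      (L : 𝓢(PhaseSpace N, ℂ) →ₗ[ℂ] moyalCStar N θ),
      (∀ f g x, mul f g x = moyalProduct θ f g x) ∧
      (∀ f, IsLeftMoyal θ f (L f : L2 N →L[ℂ] L2 N)) ∧
      (¬ ∃ e, ∀ f, mul e f = f ∧ mul f e = f) ∧
      IsFrechetPreCStarAlgebra mul (schwartzConj N) L ∧
      (∀ (f : 𝓢(PhaseSpace N, ℂ)) (g : moyalCStar N θ),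
        L f + g + L f * g = 0 → L f + g + g * L f = 0 → g ∈ Set.range L) := by
  -- Positivity of N makes phase space nontrivial; over a point the constant 1 would be a unit.
  have : Nonempty (Fin N) := ⟨⟨0, hN⟩⟩
  refine ⟨weylMul (isSkew_moyalK N θ), moyalL N hθ, fun f g x => (moyalProduct_eq_twist hθ f g x).symm,
    leftOp_isLeftMoyal hθ, fun ⟨e, he⟩ => not_exists_unit (isSkew_moyalK N θ) ⟨e, fun f => (he f).2⟩,
    isFrechetPreCStarAlgebra_moyalL N hθ, fun f g h1 h2 => ?_⟩
  exact quasiInverse_mem_range (moyalL N hθ) (fun f g => ⟨_, moyalL_mul hθ f g⟩)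
    (fun f T g => moyalL_mul_mul_mem_range hθ f g T) f g h1 h2
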